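/- **Definitions.** Let $G$ be a finite connected simple graph on $n$ vertices. - $\deg(v)$ is the degree of a vertex $v$, $\delta(G)$ is the minimum degree, and $\mathrm{girth}(G)$ is the length of a shortest cycle ($\infty$ if there is none). $\xi_3(G)$ is the minimum, over all connected subgraphs of $G$ with exactly $3$ vertices, of the number of edges of $G$ with exactly one end in the vertex set of the subgraph ($\infty$ if there is no such subgraph). - A *divisor* is a function $D:V(G)\to\mathbb Z$ (a placement of chips, negative values being debt), and its degree is $\sum_v D(v)$. Firing a vertex moves one chip from it along each incident edge; vertices may be fired any integer number of times. $D$ has *positive rank* if for every vertex $v$, after removing one chip from $v$, some chip-firing leads to a divisor with no negative value. The *gonality* $\mathrm{gon}(G)$ is the least degree of a divisor of positive rank. - A *scramble* is a nonempty collection $\mathcal S$ of nonempty connected subgraphs of $G$, called eggs. Its *hitting number* $h(\mathcal S)$ is the least size of a vertex set meeting every egg. An *egg-cut* is a set of edges whose deletion leaves two eggs of $\mathcal S$ in different components; $e(\mathcal S)$ is the least size of an egg-cut ($\infty$ if there is none). The *scramble number* $\mathrm{sn}(G)$ is the maximum of $\min\{h(\mathcal S),e(\mathcal S)\}$ over all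 scrambles $\mathcal S$ on $G$. - Two numbers $a,b$ *approximate gonality and scramble number of $G$ within a factor $\rho$* if $\mathrm{gon}(G)\le a\le\rho\cdot\mathrm{gon}(G)$ and $\mathrm{sn}(G)/\rho\le b\le\mathrm{sn}(G)$. **Theorem.** There is a polynomial-time algorithm (a deterministic Turing machine whose number of steps is bounded by a polynomial in the length of its input) which, given the adjacency matrix of a finite simple graph $G$, outputs two natural numbers $a(G),b(G)$ such that for every connected simple graph $G$ on $n$ vertices: 1. if $\mathrm{girth}(G)\ge 4$, $\delta(G)\ge 3$ and $\xi_3(G)\ge n+1$, then $a(G),b(G)$ approximate the gonality and the scramble number of $G$ within the factor $3$; 2. if $\mathrm{girth}(G)\ge 4$, $n\ge 6$ and $\delta(G)\ge \frac n3+1$, then they do so within the factor $3$; 3. if $\mathrm{girth}(G)\ge 5$, $n\ge 8$ and $\delta(G)\ge\frac12\left(\left\lfloor\frac n2\right\rfloor+4\right)$, then they do so within the factor $4$; 4. if $\deg(u)+\deg(v)\ge n$ for any two adjacent vertices $u,v$ and $\deg(u)+\deg(v)\ge n+1$ for any two distinct non-adjacent vertices $u,v$, then they do so within the factor $2$. 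-/

import Mathlib

namespace GraphApprox

/-! ### Chip-firing and gonality -/

section Gonality

variable {V : Type*} [Fintype V]

open Classical in
/-- The divisor obtained from `D` when every vertex `u` fires `σ u` times (negative values mean
borrowing): `w` sends `σ w` chips along each incident edge, and receives `σ u` chips from each
neighbour `u`. Two divisors are (linearly) equivalent iff one arises from the other in this way. -/
noncomputable def fire (G : SimpleGraph V) (D σ : V → ℤ) : V → ℤ :=
  fun w => D w + ∑ u, if G.Adj w u then σ u - σ w else 0

open Classical in
/-- A divisor has positive rank if, after one chip is removed from any vertex, chip-firing can
eliminate all debt. -/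
def HasPositiveRank (G : SimpleGraph V) (D : V → ℤ) : Prop :=
  ∀ v : V, ∃ σ : V → ℤ, ∀ w : V, 0 ≤ fire G (D - Pi.single v 1) σ w

/-- The gonality: the smallest degree (number of chips) of a divisor of positive rank. -/
noncomputable def gon (G : SimpleGraph V) : ℕ :=
  sInf {d : ℕ | ∃ D : V → ℤ, ∑ v, D v = (d : ℤ) ∧ HasPositiveRank G D}

end Gonality

/-! ### Scrambles and scramble number -/

section Scramble

variable {V : Type*}

/-- A scramble is a nonempty collection of nonempty connected subgraphs, its eggs.
(`SimpleGraph.Subgraph.Connected` includes nonemptiness.) -/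
def IsScramble (G : SimpleGraph V) (S : Set G.Subgraph) : Prop :=
  S.Nonempty ∧ ∀ H ∈ S, H.Connected

/-- The hitting number: the least size of a vertex set meeting every egg. -/
noncomputable def hittingNumber (G : SimpleGraph V) (S : Set G.Subgraph) : ℕ∞ :=
  ⨅ (T : Finset V) (_ : ∀ H ∈ S, ∃ v ∈ T, v ∈ H.verts), (T.card : ℕ∞)

/-- An egg-cut: a set of edges whose deletion leaves two eggs in different components. -/
def IsEggCut (G : SimpleGraph V) (S : Set G.Subgraph) (W : Finset (Sym2 V)) : Prop :=
  (W : Set (Sym2 V)) ⊆ G.edgeSet ∧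
    ∃ C₁ C₂ : (G.deleteEdges (W : Set (Sym2 V))).ConnectedComponent, C₁ ≠ C₂ ∧
      (∃ H ∈ S, H.verts ⊆ C₁.supp) ∧ (∃ H ∈ S, H.verts ⊆ C₂.supp)

/-- The egg-cut number: the least size of an egg-cut, and `∞` if there is none. -/
noncomputable def eggCutNumber (G : SimpleGraph V) (S : Set G.Subgraph) : ℕ∞ :=
  ⨅ (W : Finset (Sym2 V)) (_ : IsEggCut G S W), (W.card : ℕ∞)

/-- The order of a scramble. -/
noncomputable def scrambleOrder (G : SimpleGraph V) (S : Set G.Subgraph) : ℕ∞ :=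
  min (hittingNumber G S) (eggCutNumber G S)

/-- The scramble number: the largest order of a scramble. -/
noncomputable def sn (G : SimpleGraph V) : ℕ∞ :=
  ⨆ (S : Set G.Subgraph) (_ : IsScramble G S), scrambleOrder G S

end Scramble

/-! ### Outdegree of connected subgraphs -/

section Outdegree

variable {V : Type*}

/-- The number of edges with exactly one end in `X` (each is counted once, directed outwards). -/
noncomputable def outdegree (G : SimpleGraph V) (X : Set V) : ℕ :=
  {p : V × V | p.1 ∈ X ∧ p.2 ∉ X ∧ G.Adj p.1 p.2}.ncard

/-- `ξ_k(G)`: the minimum outdegree of a connected subgraph on `k` vertices (`∞` if there is no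
such subgraph). -/
noncomputable def xi (G : SimpleGraph V) (k : ℕ) : ℕ∞ :=
  ⨅ (H : G.Subgraph) (_ : H.Connected ∧ H.verts.ncard = k), (outdegree G H.verts : ℕ∞)

end Outdegree

/-! ### Approximation algorithms -/

/-- `a` is a `ρ`-approximation of the optimum of a minimization problem:
`opt ≤ a ≤ ρ * opt`. -/
def IsMinApprox (ρ : ℕ) (opt : ℕ∞) (a : ℕ) : Prop :=
  opt ≤ (a : ℕ∞) ∧ (a : ℕ∞) ≤ (ρ : ℕ∞) * opt

/-- `b` is a `ρ`-approximation of the optimum of a maximization problem: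
`opt / ρ ≤ b ≤ opt`. -/
def IsMaxApprox (ρ : ℕ) (opt : ℕ∞) (b : ℕ) : Prop :=
  opt ≤ (ρ : ℕ∞) * (b : ℕ∞) ∧ (b : ℕ∞) ≤ opt

/-- The output `(a, b)` approximates both gonality (a minimum) and scramble number (a maximum)
of `G` within the factor `ρ`. -/
def Approximates {V : Type*} [Fintype V] (ρ : ℕ) (G : SimpleGraph V) (out : ℕ × ℕ) : Prop :=
  IsMinApprox ρ (gon G : ℕ∞) out.1 ∧ IsMaxApprox ρ (sn G) out.2

/-- The inputs of graph algorithms: simple graphs with vertex set `{0, …, n - 1}`. -/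
abbrev FinGraph : Type := Σ n : ℕ, SimpleGraph (Fin n)

open Classical in
/-- A graph is written down as its adjacency matrix, row by row, with the symbol `none` at the
end of each row. -/
noncomputable def encodeGraph (x : FinGraph) : List (Option Bool) :=
  (List.finRange x.1).flatMap fun i =>
    ((List.finRange x.1).map fun j => some (decide (x.2.Adj i j))) ++ [none]

/-- A pair of natural numbers is written down in unary, with the separator `false`. -/
def encodeNatPair (p : ℕ × ℕ) : List Bool :=
  Computability.unaryEncodeNat p.1 ++ false :: Computability.unaryEncodeNat p.2

/-- `f` is computed by a (multi-stack) Turing machine whose number of steps is bounded by a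
polynomial in the length of the encoded input graph. -/
def IsPolyTime (f : FinGraph → ℕ × ℕ) : Prop :=
  Nonempty (Turing.TM2ComputableInPolyTime encodeGraph encodeNatPair f)

end GraphApprox

/-! Write n for the number of vertices. Every case is a chain b ≤ sn ≤ gon ≤ a ≤ ρ·b
(`approximates_of_le`), whose middle inequality `sn_le_gon` holds in every graph: among the
effective divisors equivalent to an optimal one, take one whose chips meet an inclusion-maximal
family of eggs. If it misses an egg, then bringing a chip there by firing a decreasing family of
level sets must at some moment lose another egg. The set fired at that moment separates two eggs,
and its boundary has at most as many edges as there are chips.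

In the triangle-free cases 1-3 the algorithm greedily packs disjoint two-edge paths into a family P
and answers (3|P|, |P|). No uncovered vertex has two uncovered neighbours at the end, so one chip on
each covered vertex has positive rank (`gon_le_of_isDissociation`). Taking all two-edge paths as
eggs, disjointness makes the hitting number at least |P|, and it remains to see that a cut with a
two-edge path on each side has at least |P| edges. Since 3|P| ≤ n, in the dense cases 2 and 3 it is
enough that Mantel's theorem inside the smaller side yields n/2 edges
(`TriangleFree.card_le_two_mul_outdegree`). In case 1 the condition on ξ₃ says that degrees along a
two-edge path sum to at least n + 5, and a charging argument compares the ends of cut edges with the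
paths of P (`TriangleFree.card_le_outdegree_of_path`).

In case 4 the answer is (n, ⌈n/2⌉): one chip everywhere, and edges as eggs (`half_card_le_sn`).

One algorithm must serve all cases, so it also records whether the adjacency matrix has more ones
than zeros. Mantel's theorem excludes this for triangle-free graphs, and the degree conditions of
case 4 force it once n ≥ 3; for n ≤ 2 the packing is empty, which cannot happen in cases 1-3. Each
row is scanned forwards and backwards once, so the running time is linear in the length n(n + 1) of
the input. -/

namespace GraphApprox

/-! ### A stack machine for greedy packing of two-edge paths -/

namespace Machine

/-- The stacks of the machine. -/
inductive Stk
  | inp | out | bal | marks | tmp | cnt₁ | cnt₂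
  deriving DecidableEq

instance : Fintype Stk :=
  ⟨{.inp, .out, .bal, .marks, .tmp, .cnt₁, .cnt₂}, fun k => by cases k <;> decide⟩

/-- The record kept of a vertex: whether it is covered by the packing, and whether its row has
been read. -/
structure Mark where
  covered : Bool
  done : Bool
  deriving DecidableEq, Fintype

/-- The record kept of a vertex while the current row is processed: its mark, whether it is an
uncovered neighbour of the current vertex, and whether it is the current vertex. -/
structure Entry where
  mark : Mark
  free : Bool
  current : Bool
  deriving DecidableEq, Fintype

/-- The (finite) stack alphabets. -/
abbrev Sym : Stk → Type
  | .inp => Option Bool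
  | .out => Bool
  | .bal => Bool
  | .marks => Mark
  | .tmp => Entry
  | .cnt₁ => Unit
  | .cnt₂ => Unit

instance Sym.fintype : ∀ k, Fintype (Sym k)
  | .inp => inferInstanceAs (Fintype (Option Bool))
  | .out => inferInstanceAs (Fintype Bool)
  | .bal => inferInstanceAs (Fintype Bool)
  | .marks => inferInstanceAs (Fintype Mark)
  | .tmp => inferInstanceAs (Fintype Entry)
  | .cnt₁ => inferInstanceAs (Fintype Unit)
  | .cnt₂ => inferInstanceAs (Fintype Unit)

/-- The labels of the machine. -/
inductive Label
  | forward | backward | decide | halves | whole | single | triple | clean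
  deriving DecidableEq

instance : Fintype Label :=
  ⟨{.forward, .backward, .decide, .halves, .whole, .single, .triple, .clean},
    fun l => by cases l <;> decide⟩

/-- The control part of the state: whether the current vertex has been met, whether it is
uncovered, and a number from `{0, 1, 2}` in unary. -/
structure Ctl where
  seen : Bool
  centre : Bool
  one : Bool
  two : Bool
  deriving DecidableEq, Fintype

/-- The internal state: registers for symbols that have been read, and the control part. -/
structure Var where
  sym : Option (Option Bool)
  top : Option Bool
  mark : Mark
  entry : Option Entry
  flag : Bool
  ctl : Ctl
  deriving DecidableEq, Fintype

/-- The mark of a vertex about which nothing is known. -/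
def Mark.fresh : Mark := ⟨false, false⟩

/-- The control part at the beginning of a row. -/
def Ctl.init : Ctl := ⟨false, false, false, false⟩

/-- The state with empty registers. -/
def Var.ofCtl (c : Ctl) : Var := ⟨none, none, Mark.fresh, none, false, c⟩

/-- The entry for the next vertex of the row, where `b` is the adjacency bit. -/
def Ctl.entry (c : Ctl) (b : Bool) (m : Mark) : Entry :=
  ⟨⟨m.covered, m.done || !c.seen⟩, b && !m.covered, !m.done && !c.seen⟩

/-- The control part after the next vertex of the row has been read. -/
def Ctl.forward (c : Ctl) (b : Bool) (m : Mark) : Ctl :=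
  ⟨c.seen || !m.done, c.centre || (!m.done && !c.seen && !m.covered),
    c.one || (b && !m.covered), c.two || (c.one && (b && !m.covered))⟩

/-- The control part at the end of a row. -/
def Ctl.turn (c : Ctl) : Ctl :=
  bif c.centre && c.two then ⟨true, true, true, true⟩ else Ctl.init

/-- The new mark of a vertex when a row has been processed. -/
def Ctl.mark (c : Ctl) (e : Entry) : Mark :=
  ⟨e.mark.covered || (e.current && c.centre) || (e.free && c.one), e.mark.done⟩

/-- The control part after an entry has been processed. -/
def Ctl.backward (c : Ctl) (e : Entry) : Ctl :=
  bif e.free && c.one then ⟨c.seen, c.centre, c.two, false⟩ else c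

/-- The bit that has been read. -/
def Var.bit (s : Var) : Bool := (s.sym.getD none).getD false

open Turing.TM2.Stmt in
/-- The program. -/
def program : Label → Turing.TM2.Stmt Sym Label Var
  | .forward =>
    pop .inp (fun s o => { s with sym := o }) <|
    branch (fun s => s.sym.isNone) (load (fun _ => Var.ofCtl Ctl.init) <| goto fun _ => .decide) <|
    branch (fun s => (s.sym.getD none).isNone)
      (load (fun s => Var.ofCtl s.ctl.turn) <|
        -- After `Ctl.turn`, `centre` says that a new path is being added. The size of the packing
        -- is stored twice because reading a counter empties it: one copy is for |P|, the other for
        -- 3|P|.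
        branch (fun s => s.ctl.centre)
          (push .cnt₁ (fun _ => ()) <| push .cnt₂ (fun _ => ()) <| goto fun _ => .backward)
          (goto fun _ => .backward)) <|
    -- The stack of marks is empty during the first row. The default is then correct for every
    -- vertex, so no initialisation pass is needed.
    pop .marks (fun s o => { s with mark := o.getD Mark.fresh }) <|
    push .tmp (fun s => s.ctl.entry s.bit s.mark) <|
    pop .bal (fun s o => { s with top := o }) <|
    branch (fun s => s.top.isNone)
      (push .bal (fun s => s.bit) <|
        load (fun s => Var.ofCtl (s.ctl.forward s.bit s.mark)) <| goto fun _ => .forward) <|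
    -- The balance stack never holds two different bits: equal bits accumulate and opposite ones
    -- cancel.
    branch (fun s => s.top == some s.bit)
      (push .bal (fun s => s.bit) <| push .bal (fun s => s.bit) <|
        load (fun s => Var.ofCtl (s.ctl.forward s.bit s.mark)) <| goto fun _ => .forward)
      (load (fun s => Var.ofCtl (s.ctl.forward s.bit s.mark)) <| goto fun _ => .forward)
  | .backward =>
    pop .tmp (fun s o => { s with entry := o }) <|
    branch (fun s => s.entry.isNone)
      (load (fun _ => Var.ofCtl Ctl.init) <| goto fun _ => .forward) <|
    push .marks (fun s => s.ctl.mark (s.entry.getD ⟨Mark.fresh, false, false⟩)) <|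
    load (fun s => Var.ofCtl (s.ctl.backward (s.entry.getD ⟨Mark.fresh, false, false⟩))) <|
    goto fun _ => .backward
  | .decide =>
    peek .bal (fun s o => { s with top := o }) <|
    peek .cnt₁ (fun s o => { s with flag := o.isNone }) <|
    branch (fun s => s.top == some true || s.flag)
      (load (fun _ => Var.ofCtl Ctl.init) <| goto fun _ => .halves)
      (load (fun _ => Var.ofCtl Ctl.init) <| goto fun _ => .single)
  | .halves =>
    pop .marks (fun s o => { s with flag := o.isSome }) <|
    branch (fun s => s.flag)
      (push .tmp (fun _ => ⟨Mark.fresh, false, false⟩) <|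
        -- In this loop `seen` is the parity of the number of marks read; writing on odd turns gives
        -- ⌈n/2⌉. The second component is written first because the output is a stack.
        branch (fun s => s.ctl.seen)
          (load (fun _ => Var.ofCtl Ctl.init) <| goto fun _ => .halves)
          (push .out (fun _ => true) <|
            load (fun _ => Var.ofCtl ⟨true, false, false, false⟩) <| goto fun _ => .halves))
      (push .out (fun _ => false) <|
        load (fun _ => Var.ofCtl Ctl.init) <| goto fun _ => .whole)
  | .whole =>
    pop .tmp (fun s o => { s with flag := o.isSome }) <|
    branch (fun s => s.flag)
      (push .out (fun _ => true) <| load (fun _ => Var.ofCtl Ctl.init) <| goto fun _ => .whole)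
      (load (fun _ => Var.ofCtl Ctl.init) <| goto fun _ => .clean)
  | .single =>
    pop .cnt₁ (fun s o => { s with flag := o.isSome }) <|
    branch (fun s => s.flag)
      (push .out (fun _ => true) <| load (fun _ => Var.ofCtl Ctl.init) <| goto fun _ => .single)
      (push .out (fun _ => false) <| load (fun _ => Var.ofCtl Ctl.init) <| goto fun _ => .triple)
  | .triple =>
    pop .cnt₂ (fun s o => { s with flag := o.isSome }) <|
    branch (fun s => s.flag)
      (push .out (fun _ => true) <| push .out (fun _ => true) <| push .out (fun _ => true) <|
        load (fun _ => Var.ofCtl Ctl.init) <| goto fun _ => .triple)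
      (load (fun _ => Var.ofCtl Ctl.init) <| goto fun _ => .clean)
  | .clean =>
    pop .bal (fun s o => { s with flag := o.isSome }) <|
    pop .marks (fun s o => { s with flag := s.flag || o.isSome }) <|
    pop .cnt₁ (fun s o => { s with flag := s.flag || o.isSome }) <|
    pop .cnt₂ (fun s o => { s with flag := s.flag || o.isSome }) <|
    branch (fun s => s.flag)
      (load (fun _ => Var.ofCtl Ctl.init) <| goto fun _ => .clean)
      (load (fun _ => Var.ofCtl Ctl.init) <| halt)

/-- The machine. All of its alphabets are finite. -/
def machine : Turing.FinTM2 where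
  K := Stk
  k₀ := .inp
  k₁ := .out
  Γ := Sym
  Λ := Label
  main := .forward
  σ := Var
  initialState := Var.ofCtl Ctl.init
  Γk₀Fin := Sym.fintype .inp
  m := program

/-- The contents of all stacks. -/
def contents (inp : List (Option Bool)) (out bal : List Bool) (marks : List Mark) (tmp : List Entry)
    (cnt₁ cnt₂ : List Unit) : ∀ k, List (Sym k)
  | .inp => inp
  | .out => out
  | .bal => bal
  | .marks => marks
  | .tmp => tmp
  | .cnt₁ => cnt₁
  | .cnt₂ => cnt₂

section Stacks

variable (inp : List (Option Bool)) (out bal : List Bool) (marks : List Mark) (tmp : List Entry)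
  (cnt₁ cnt₂ : List Unit)

@[simp] lemma contents_inp : contents inp out bal marks tmp cnt₁ cnt₂ .inp = inp := rfl
@[simp] lemma contents_out : contents inp out bal marks tmp cnt₁ cnt₂ .out = out := rfl
@[simp] lemma contents_bal : contents inp out bal marks tmp cnt₁ cnt₂ .bal = bal := rfl
@[simp] lemma contents_marks : contents inp out bal marks tmp cnt₁ cnt₂ .marks = marks := rfl
@[simp] lemma contents_tmp : contents inp out bal marks tmp cnt₁ cnt₂ .tmp = tmp := rfl
@[simp] lemma contents_cnt₁ : contents inp out bal marks tmp cnt₁ cnt₂ .cnt₁ = cnt₁ := rfl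
@[simp] lemma contents_cnt₂ : contents inp out bal marks tmp cnt₁ cnt₂ .cnt₂ = cnt₂ := rfl

@[simp] lemma update_inp (x : List (Option Bool)) :
    Function.update (contents inp out bal marks tmp cnt₁ cnt₂) .inp x =
      contents x out bal marks tmp cnt₁ cnt₂ := by
  funext k; cases k <;> rfl

@[simp] lemma update_out (x : List Bool) :
    Function.update (contents inp out bal marks tmp cnt₁ cnt₂) .out x =
      contents inp x bal marks tmp cnt₁ cnt₂ := by
  funext k; cases k <;> rfl

@[simp] lemma update_bal (x : List Bool) :
    Function.update (contents inp out bal marks tmp cnt₁ cnt₂) .bal x =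
      contents inp out x marks tmp cnt₁ cnt₂ := by
  funext k; cases k <;> rfl

@[simp] lemma update_marks (x : List Mark) :
    Function.update (contents inp out bal marks tmp cnt₁ cnt₂) .marks x =
      contents inp out bal x tmp cnt₁ cnt₂ := by
  funext k; cases k <;> rfl

@[simp] lemma update_tmp (x : List Entry) :
    Function.update (contents inp out bal marks tmp cnt₁ cnt₂) .tmp x =
      contents inp out bal marks x cnt₁ cnt₂ := by
  funext k; cases k <;> rfl

@[simp] lemma update_cnt₁ (x : List Unit) :
    Function.update (contents inp out bal marks tmp cnt₁ cnt₂) .cnt₁ x =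
      contents inp out bal marks tmp x cnt₂ := by
  funext k; cases k <;> rfl

@[simp] lemma update_cnt₂ (x : List Unit) :
    Function.update (contents inp out bal marks tmp cnt₁ cnt₂) .cnt₂ x =
      contents inp out bal marks tmp cnt₁ x := by
  funext k; cases k <;> rfl

end Stacks

/-! ### Runs of the machine and the signed unary counter -/

/-- Configurations. -/
abbrev Config : Type := Turing.TM2.Cfg Sym Label Var

/-- The configuration with label `l`, control part `c`, empty registers and the given stacks. -/
def config (l : Label) (c : Ctl) (inp : List (Option Bool)) (out bal : List Bool)
    (marks : List Mark) (tmp : List Entry) (cnt₁ cnt₂ : List Unit) : Config :=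
  ⟨some l, Var.ofCtl c, contents inp out bal marks tmp cnt₁ cnt₂⟩

/-- The machine gets from `a` to `b` in at most `t` steps. -/
def RunsIn (a b : Config) (t : ℕ) : Prop :=
  ∃ s ≤ t, (flip bind (Turing.TM2.step program))^[s] (some a) = some b

lemma RunsIn.refl (a : Config) : RunsIn a a 0 := ⟨0, le_rfl, rfl⟩

lemma RunsIn.trans {a b c : Config} {s t : ℕ} (h₁ : RunsIn a b s) (h₂ : RunsIn b c t) :
    RunsIn a c (s + t) := by
  obtain ⟨s', hs, h₁⟩ := h₁
  obtain ⟨t', ht, h₂⟩ := h₂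
  exact ⟨t' + s', by omega, by rw [Function.iterate_add_apply, h₁, h₂]⟩

lemma RunsIn.mono {a b : Config} {s t : ℕ} (h : RunsIn a b s) (hst : s ≤ t) : RunsIn a b t := by
  obtain ⟨s', hs, h⟩ := h
  exact ⟨s', hs.trans hst, h⟩

lemma RunsIn.of_step {a b : Config} (h : Turing.TM2.step program a = some b) : RunsIn a b 1 :=
  ⟨1, le_rfl, h⟩

/-- The unary representation of an integer: its absolute value many copies of its sign. -/
def unary (z : ℤ) : List Bool := List.replicate z.natAbs (0 < z : Bool)

lemma unary_length (z : ℤ) : (unary z).length = z.natAbs := by simp [unary]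

lemma unary_head?_eq {z : ℤ} : (unary z).head? = some true ↔ 0 < z := by
  rcases lt_trichotomy z 0 with h | h | h
  · have : z.natAbs ≠ 0 := by omega
    simp [unary, List.head?_replicate, this]
  · simp [unary, h]
  · have : z.natAbs ≠ 0 := by omega
    simp [unary, List.head?_replicate, this]

lemma unary_ofNat_succ (k : ℕ) : unary ((k : ℤ) + 1) = true :: List.replicate k true := by
  have h1 : ((k : ℤ) + 1).natAbs = k + 1 := by omega
  have h2 : (0 : ℤ) < (k : ℤ) + 1 := by omega
  simp [unary, h1, h2, List.replicate_succ]

lemma unary_neg_succ (k : ℕ) : unary (-(k : ℤ) - 1) = false :: List.replicate k false := by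
  have h1 : (-(k : ℤ) - 1).natAbs = k + 1 := by omega
  have h2 : ¬ (0 : ℤ) < -(k : ℤ) - 1 := by omega
  simp only [unary, h1, h2, decide_false, List.replicate_succ]

/-- The effect on the balance of reading a bit. -/
def push (b : Bool) (l : List Bool) : List Bool :=
  match l with
  | [] => [b]
  | c :: l => if c = b then b :: b :: l else l

/-- Justifies the balance stack as a counter for ones minus zeros, whose top symbol shows the sign.
-/
lemma push_unary (b : Bool) (z : ℤ) : push b (unary z) = unary (z + if b then 1 else -1) := by
  rcases lt_trichotomy z 0 with h | h | h
  · obtain ⟨k, rfl⟩ : ∃ k : ℕ, z = -(k : ℤ) - 1 := ⟨(-z - 1).toNat, by omega⟩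
    rw [unary_neg_succ]
    cases b
    · rw [show -(k : ℤ) - 1 + (if false = true then 1 else -1) = -((k + 1 : ℕ) : ℤ) - 1 by
        push_cast; simp; ring, unary_neg_succ]
      simp [push, List.replicate_succ]
    · cases k with
      | zero => simp [push, unary]
      | succ k =>
        rw [show -((k + 1 : ℕ) : ℤ) - 1 + (if true = true then 1 else -1) = -(k : ℤ) - 1 by
          push_cast; simp; ring, unary_neg_succ]
        simp [push, List.replicate_succ]
  · subst h; cases b <;> simp [push, unary]
  · obtain ⟨k, rfl⟩ : ∃ k : ℕ, z = (k : ℤ) + 1 := ⟨(z - 1).toNat, by omega⟩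
    rw [unary_ofNat_succ]
    cases b
    · cases k with
      | zero => simp [push, unary]
      | succ k =>
        rw [show ((k + 1 : ℕ) : ℤ) + 1 + (if false = true then 1 else -1) = (k : ℤ) + 1 by
          push_cast; simp, unary_ofNat_succ]
        simp [push, List.replicate_succ]
    · rw [show (k : ℤ) + 1 + (if true = true then 1 else -1) = ((k + 1 : ℕ) : ℤ) + 1 by
        push_cast; simp, unary_ofNat_succ]
      simp [push, List.replicate_succ]

/-! ### Single steps and loops -/

section Steps

variable (c : Ctl) (inp : List (Option Bool)) (out bal : List Bool) (marks : List Mark)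
  (tmp : List Entry) (cnt₁ cnt₂ : List Unit)

lemma step_forward_bit (b : Bool) :
    RunsIn (config .forward c (some b :: inp) out bal marks tmp cnt₁ cnt₂)
      (config .forward (c.forward b (marks.head?.getD Mark.fresh)) inp out (push b bal) marks.tail
        (c.entry b (marks.head?.getD Mark.fresh) :: tmp) cnt₁ cnt₂) 1 := by
  refine RunsIn.of_step ?_
  cases bal with
  | nil => simp [config, program, Var.ofCtl, Var.bit, push]
  | cons x bal =>
    by_cases hx : x = b
    · subst hx; simp [config, program, Var.ofCtl, Var.bit, push]
    · simp [config, program, Var.ofCtl, Var.bit, push, hx, beq_eq_false_iff_ne.2 hx]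

lemma step_forward_end :
    RunsIn (config .forward c (none :: inp) out bal marks tmp cnt₁ cnt₂)
      (config .backward c.turn inp out bal marks tmp
        (if c.centre && c.two then () :: cnt₁ else cnt₁)
        (if c.centre && c.two then () :: cnt₂ else cnt₂)) 1 := by
  refine RunsIn.of_step ?_
  by_cases h : (c.centre && c.two) = true
  · simp [config, program, Var.ofCtl, Ctl.turn, h]
  · simp [config, program, Var.ofCtl, Ctl.turn, Ctl.init, h]

lemma step_forward_nil :
    RunsIn (config .forward c [] out bal marks tmp cnt₁ cnt₂)
      (config .decide Ctl.init [] out bal marks tmp cnt₁ cnt₂) 1 :=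
  RunsIn.of_step <| by simp [config, program, Var.ofCtl]

lemma step_backward_cons (e : Entry) :
    RunsIn (config .backward c inp out bal marks (e :: tmp) cnt₁ cnt₂)
      (config .backward (c.backward e) inp out bal (c.mark e :: marks) tmp cnt₁ cnt₂) 1 :=
  RunsIn.of_step <| by simp [config, program, Var.ofCtl]

lemma step_backward_nil :
    RunsIn (config .backward c inp out bal marks [] cnt₁ cnt₂)
      (config .forward Ctl.init inp out bal marks [] cnt₁ cnt₂) 1 :=
  RunsIn.of_step <| by simp [config, program, Var.ofCtl]

lemma step_decide :
    RunsIn (config .decide c inp out bal marks tmp cnt₁ cnt₂)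
      (config (if bal.head? = some true ∨ cnt₁ = [] then .halves else .single)
        Ctl.init inp out bal marks tmp cnt₁ cnt₂) 1 := by
  refine RunsIn.of_step ?_
  by_cases h : bal.head? = some true
  · simp [config, program, Var.ofCtl, h]
  · cases cnt₁ <;> simp [config, program, Var.ofCtl, h, beq_eq_false_iff_ne.2 h]

lemma run_halves (l : ℕ) (par : Bool) (h : marks.length = l) :
    RunsIn (config .halves ⟨par, false, false, false⟩ inp out bal marks tmp cnt₁ cnt₂)
      (config .whole Ctl.init inp
        (false :: (List.replicate ((l + if par then 0 else 1) / 2) true ++ out)) bal []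
        (List.replicate l ⟨Mark.fresh, false, false⟩ ++ tmp) cnt₁ cnt₂) (l + 1) := by
  induction l generalizing marks par out tmp with
  | zero =>
    obtain rfl := List.length_eq_zero_iff.1 h
    refine RunsIn.of_step ?_
    cases par <;> simp [config, program, Var.ofCtl]
  | succ l ih =>
    obtain ⟨m, marks, rfl⟩ := List.exists_cons_of_length_eq_add_one h
    have h' : marks.length = l := by simpa using h
    cases par
    · have hs : RunsIn (config .halves ⟨false, false, false, false⟩ inp out bal (m :: marks) tmp
          cnt₁ cnt₂) (config .halves ⟨true, false, false, false⟩ inp (true :: out) bal marks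
          (⟨Mark.fresh, false, false⟩ :: tmp) cnt₁ cnt₂) 1 :=
        RunsIn.of_step (by simp [config, program, Var.ofCtl])
      convert (hs.trans (ih (true :: out) marks _ true h')).mono
        (by omega : _ ≤ l + 1 + 1) using 2
      · rw [show (l + 1 + if false = true then 0 else 1) / 2
          = (l + if true = true then 0 else 1) / 2 + 1 by simp; omega, List.replicate_succ']
        simp
      · rw [List.replicate_succ']; simp
    · have hs : RunsIn (config .halves ⟨true, false, false, false⟩ inp out bal (m :: marks) tmp
          cnt₁ cnt₂) (config .halves ⟨false, false, false, false⟩ inp out bal marks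
          (⟨Mark.fresh, false, false⟩ :: tmp) cnt₁ cnt₂) 1 :=
        RunsIn.of_step (by simp [config, program, Var.ofCtl, Ctl.init])
      convert (hs.trans (ih out marks _ false h')).mono (by omega : _ ≤ l + 1 + 1) using 2
      · simp
      · rw [List.replicate_succ']; simp

lemma run_whole :
    RunsIn (config .whole Ctl.init inp out bal marks tmp cnt₁ cnt₂)
      (config .clean Ctl.init inp (List.replicate tmp.length true ++ out) bal marks [] cnt₁ cnt₂)
      (tmp.length + 1) := by
  induction tmp generalizing out with
  | nil => exact RunsIn.of_step (by simp [config, program, Var.ofCtl])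
  | cons e tmp ih =>
    have h : RunsIn (config .whole Ctl.init inp out bal marks (e :: tmp) cnt₁ cnt₂)
        (config .whole Ctl.init inp (true :: out) bal marks tmp cnt₁ cnt₂) 1 :=
      RunsIn.of_step (by simp [config, program, Var.ofCtl])
    convert (h.trans (ih (true :: out))).mono (by simp; omega : _ ≤ (e :: tmp).length + 1) using 2
    rw [List.length_cons, List.replicate_succ']; simp

lemma run_single :
    RunsIn (config .single Ctl.init inp out bal marks tmp cnt₁ cnt₂)
      (config .triple Ctl.init inp (false :: (List.replicate cnt₁.length true ++ out)) bal marks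
        tmp [] cnt₂) (cnt₁.length + 1) := by
  induction cnt₁ generalizing out with
  | nil => exact RunsIn.of_step (by simp [config, program, Var.ofCtl])
  | cons e cnt₁ ih =>
    have h : RunsIn (config .single Ctl.init inp out bal marks tmp (e :: cnt₁) cnt₂)
        (config .single Ctl.init inp (true :: out) bal marks tmp cnt₁ cnt₂) 1 :=
      RunsIn.of_step (by simp [config, program, Var.ofCtl])
    convert (h.trans (ih (true :: out))).mono (by simp; omega : _ ≤ (e :: cnt₁).length + 1) using 2
    rw [List.length_cons, List.replicate_succ']; simp

lemma run_triple :
    RunsIn (config .triple Ctl.init inp out bal marks tmp cnt₁ cnt₂)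
      (config .clean Ctl.init inp (List.replicate (3 * cnt₂.length) true ++ out) bal marks
        tmp cnt₁ []) (cnt₂.length + 1) := by
  induction cnt₂ generalizing out with
  | nil => exact RunsIn.of_step (by simp [config, program, Var.ofCtl])
  | cons e cnt₂ ih =>
    have h : RunsIn (config .triple Ctl.init inp out bal marks tmp cnt₁ (e :: cnt₂))
        (config .triple Ctl.init inp (true :: true :: true :: out) bal marks tmp cnt₁ cnt₂) 1 :=
      RunsIn.of_step (by simp [config, program, Var.ofCtl])
    convert (h.trans (ih (true :: true :: true :: out))).mono
      (by simp; omega : _ ≤ (e :: cnt₂).length + 1) using 2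
    rw [List.length_cons, show 3 * (cnt₂.length + 1) = 3 * cnt₂.length + 3 by ring,
      List.replicate_add]
    simp [List.replicate]

/-- A halting configuration must have all stacks but the output empty. Each round pops all four
remaining stacks, so the time is governed by the longest one. -/
lemma run_clean (N : ℕ) (h₁ : bal.length ≤ N) (h₂ : marks.length ≤ N) (h₃ : cnt₁.length ≤ N)
    (h₄ : cnt₂.length ≤ N) :
    RunsIn (config .clean Ctl.init [] out bal marks [] cnt₁ cnt₂)
      ⟨none, Var.ofCtl Ctl.init, contents [] out [] [] [] [] []⟩ (N + 1) := by
  induction N generalizing bal marks cnt₁ cnt₂ with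
  | zero =>
    simp only [Nat.le_zero, List.length_eq_zero_iff] at h₁ h₂ h₃ h₄
    subst h₁ h₂ h₃ h₄
    exact RunsIn.of_step (by simp [config, program, Var.ofCtl])
  | succ N ih =>
    by_cases hall : bal = [] ∧ marks = [] ∧ cnt₁ = [] ∧ cnt₂ = []
    · obtain ⟨rfl, rfl, rfl, rfl⟩ := hall
      exact (RunsIn.of_step (by simp [config, program, Var.ofCtl])).mono
        (by omega : 1 ≤ N + 1 + 1)
    · have h : RunsIn (config .clean Ctl.init [] out bal marks [] cnt₁ cnt₂)
          (config .clean Ctl.init [] out bal.tail marks.tail [] cnt₁.tail cnt₂.tail) 1 := by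
        refine RunsIn.of_step ?_
        cases bal <;> cases marks <;> cases cnt₁ <;> cases cnt₂ <;>
          first
          | exact absurd ⟨rfl, rfl, rfl, rfl⟩ hall
          | simp [config, program, Var.ofCtl]
      refine (h.trans (ih _ _ _ _ ?_ ?_ ?_ ?_)).mono (by omega) <;>
        (rw [List.length_tail]; omega)

end Steps

end Machine

/-! ### Packings of two-edge paths -/

/-- A family of pairwise disjoint vertex sets of (not necessarily induced) two-edge paths. -/
structure IsPathPacking {V : Type*} [DecidableEq V] (G : SimpleGraph V) (P : Finset (Finset V)) :
    Prop where
  disjoint : (P : Set (Finset V)).PairwiseDisjoint id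
  path : ∀ p ∈ P, ∃ u v w, G.Adj v u ∧ G.Adj v w ∧ u ≠ w ∧ p = {u, v, w}

/-- A set of vertices in which no vertex has two neighbours. -/
def IsDissociation {V : Type*} (G : SimpleGraph V) (X : Set V) : Prop :=
  ∀ v ∈ X, ∀ u ∈ X, ∀ w ∈ X, G.Adj v u → G.Adj v w → u = w

/-! ### The effect of one row and of the whole matrix -/

namespace Machine

variable {n : ℕ}

/-- The control part with a given counter. -/
def Ctl.mk' (seen centre : Bool) (k : ℕ) : Ctl := ⟨seen, centre, decide (1 ≤ k), decide (2 ≤ k)⟩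

/-- The entry of vertex `i` while the row `r` of `v` is processed and `μ` is the set of covered
vertices. -/
def rowEntry (r μ : Fin n → Bool) (v i : Fin n) : Entry :=
  ⟨⟨μ i, decide (i ≤ v)⟩, r i && !μ i, decide (i = v)⟩

/-- The contribution of a list of bits to the balance. -/
def bitSum (l : List Bool) : ℤ := (l.map fun b => if b then (1 : ℤ) else -1).sum

lemma bitSum_natAbs_le (l : List Bool) : (bitSum l).natAbs ≤ l.length := by
  induction l with
  | nil => simp [bitSum]
  | cons b l ih =>
    have : bitSum (b :: l) = (if b then (1 : ℤ) else -1) + bitSum l := by simp [bitSum]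
    rw [this, List.length_cons]
    cases b <;> simp <;> omega

/-- Induction over a final segment `L` of the row. The current vertex is recognised as the first one
whose mark is not `done`, so `seen` has to mean that `v` has already left `L`. The second
alternative for `marks` is the first row, where defaults are read. -/
lemma run_forward_row (r μ : Fin n → Bool) (v : Fin n) (L : List (Fin n))
    (hL : L.Pairwise (· < ·)) (hv : v ∉ L → ∀ i ∈ L, v < i) (seen centre : Bool)
    (hseen : seen = decide (v ∉ L)) (k : ℕ) (inp : List (Option Bool)) (out : List Bool) (z : ℤ)
    (marks : List Mark)
    (hm : marks = L.map (fun i => ⟨μ i, decide (i < v)⟩) ∨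
      marks = [] ∧ ∀ i ∈ L, (⟨μ i, decide (i < v)⟩ : Mark) = Mark.fresh)
    (tmp : List Entry) (cnt₁ cnt₂ : List Unit) :
    ∃ seen' : Bool,
      RunsIn (config .forward (Ctl.mk' seen centre k) (L.map (fun i => some (r i)) ++ inp) out
          (unary z) marks tmp cnt₁ cnt₂)
        (config .forward
          (Ctl.mk' seen' (centre || (decide (v ∈ L) && !μ v)) (k + L.countP fun i => r i && !μ i))
          inp out (unary (z + bitSum (L.map r))) [] ((L.map (rowEntry r μ v)).reverse ++ tmp)
          cnt₁ cnt₂) L.length := by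
  induction L generalizing seen centre k z marks tmp with
  | nil =>
    have : marks = [] := by simpa using hm
    subst this
    exact ⟨seen, by simpa [bitSum] using RunsIn.refl _⟩
  | cons i L ih =>
    rw [List.pairwise_cons] at hL
    have hhead : marks.head?.getD Mark.fresh = ⟨μ i, decide (i < v)⟩ := by
      rcases hm with rfl | ⟨rfl, h⟩
      · simp
      · simpa using (h i (by simp)).symm
    have htail : marks.tail = L.map (fun i => ⟨μ i, decide (i < v)⟩) ∨
        marks.tail = [] ∧ ∀ i ∈ L, (⟨μ i, decide (i < v)⟩ : Mark) = Mark.fresh := by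
      rcases hm with rfl | ⟨rfl, h⟩
      · simp
      · exact Or.inr ⟨rfl, fun j hj => h j (List.mem_cons_of_mem _ hj)⟩
    have hv' : v ∉ L → ∀ j ∈ L, v < j := by
      intro hvL j hj
      by_cases hvi : v = i
      · exact hvi ▸ hL.1 j hj
      · exact hv (by simp [hvi, hvL]) j (List.mem_cons_of_mem _ hj)
    have hnext : (seen || !decide (i < v)) = decide (v ∉ L) := by
      rw [hseen]
      by_cases hvL : v ∈ L
      · simp [hvL, hL.1 v hvL]
      · by_cases hvi : v = i
        · subst hvi; simp [hvL]
        · simp [hvL, hvi]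
    have hcur : (!decide (i < v) && !seen) = decide (i = v) := by
      rw [hseen]
      by_cases hvi : i = v
      · subst hvi; simp
      · by_cases hvL : v ∈ L
        · simp [hvL, hL.1 v hvL, hvi]
        · have h1 : ¬ v = i := fun h => hvi h.symm
          simp [hvL, h1, hvi]
    have hle : (decide (i < v) || !seen) = decide (i ≤ v) := by
      rcases lt_trichotomy i v with h | h | h
      · simp [h, h.le]
      · subst h; simp [hseen, -List.mem_cons]
      · have h1 : v ∉ i :: L := by
          rw [List.mem_cons]
          rintro (rfl | h')
          · exact lt_irrefl _ h
          · exact lt_asymm h (hL.1 v h')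
        simp [hseen, h1, h.not_gt, h.not_ge]
    have hstep := step_forward_bit (Ctl.mk' seen centre k) (L.map (fun i => some (r i)) ++ inp) out
      (unary z) marks tmp cnt₁ cnt₂ (r i)
    rw [hhead, push_unary] at hstep
    have hentry : (Ctl.mk' seen centre k).entry (r i) ⟨μ i, decide (i < v)⟩ = rowEntry r μ v i := by
      simp only [Ctl.entry, Ctl.mk', rowEntry, hcur, hle]
    have hctl : (Ctl.mk' seen centre k).forward (r i) ⟨μ i, decide (i < v)⟩ =
        Ctl.mk' (seen || !decide (i < v)) (centre || (decide (i = v) && !μ i))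
          (k + if r i && !μ i then 1 else 0) := by
      simp only [Ctl.forward, Ctl.mk', hcur]
      cases hb : (r i && !μ i)
      · simp
      -- The two bits count free neighbours only up to two, as `Ctl.mk'` does.
      · rcases k with _ | _ | k <;> simp
    rw [hentry, hctl] at hstep
    obtain ⟨seen', hrun⟩ := ih hL.2 hv' _ (centre || (decide (i = v) && !μ i)) hnext
      (k + if r i && !μ i then 1 else 0) (z + if r i = true then 1 else -1) marks.tail htail
      (rowEntry r μ v i :: tmp)
    have hc : (centre || (decide (v ∈ i :: L) && !μ v)) =
        (centre || (decide (i = v) && !μ i) || (decide (v ∈ L) && !μ v)) := by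
      by_cases h : i = v
      · subst h
        by_cases hvL : i ∈ L <;> simp [hvL]
      · have h' : ¬ v = i := fun h' => h h'.symm
        simp [h, h']
    have hk : k + (i :: L).countP (fun i => r i && !μ i) =
        (k + if r i && !μ i then 1 else 0) + L.countP fun i => r i && !μ i := by
      rw [List.countP_cons]; ring
    have hz : z + bitSum ((i :: L).map r) =
        (z + if r i = true then 1 else -1) + bitSum (L.map r) := by
      simp [bitSum, add_assoc]
    refine ⟨seen', ?_⟩
    rw [hc, hk, hz, List.map_cons, List.map_cons, List.reverse_cons, List.append_assoc,
      List.singleton_append]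
    exact (hstep.trans hrun).mono (by simp; omega)

/-- The counter `k` now says how many free neighbours are still to be covered, and the first ones
popped are taken. Popping also restores the order of the marks, which the forward pass reversed. -/
lemma run_backward_row (r μ : Fin n → Bool) (v : Fin n) (L : List (Fin n)) (hL : L.Nodup)
    (seen centre : Bool) (k : ℕ) (hk : k ≤ 2) (inp : List (Option Bool)) (out bal : List Bool)
    (marks : List Mark) (cnt₁ cnt₂ : List Unit) :
    ∃ T : Finset (Fin n), (∀ i ∈ T, i ∈ L ∧ r i = true ∧ μ i = false) ∧
      T.card = min k (L.countP fun i => r i && !μ i) ∧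
      RunsIn (config .backward (Ctl.mk' seen centre k) inp out bal marks
          (L.map (rowEntry r μ v)) cnt₁ cnt₂)
        (config .forward Ctl.init inp out bal
          ((L.map fun i =>
            (⟨μ i || (decide (i = v) && centre) || decide (i ∈ T), decide (i ≤ v)⟩ : Mark)).reverse
            ++ marks) [] cnt₁ cnt₂) (L.length + 1) := by
  induction L generalizing k marks with
  | nil => exact ⟨∅, by simp, by simp, step_backward_nil ..⟩
  | cons i L ih =>
    rw [List.nodup_cons] at hL
    have hstep := step_backward_cons (Ctl.mk' seen centre k) inp out bal marks
      (L.map (rowEntry r μ v)) cnt₁ cnt₂ (rowEntry r μ v i)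
    by_cases hb : (r i && !μ i) = true ∧ 1 ≤ k
    · obtain ⟨T, hT, hcard, hrun⟩ := ih hL.2 (k - 1) (by omega)
        ((Ctl.mk' seen centre k).mark (rowEntry r μ v i) :: marks)
      have hctl : (Ctl.mk' seen centre k).backward (rowEntry r μ v i) =
          Ctl.mk' seen centre (k - 1) := by
        obtain ⟨hb, hk1⟩ := hb
        simp only [Ctl.backward, Ctl.mk', rowEntry, hb, hk1]
        interval_cases k <;> simp
      rw [hctl] at hstep
      have hiT : i ∉ T := fun h => hL.1 (hT i h).1
      refine ⟨insert i T, ?_, ?_, ?_⟩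
      · intro j hj
        rcases Finset.mem_insert.1 hj with rfl | hj
        · simpa using hb.1
        · exact ⟨List.mem_cons_of_mem _ (hT j hj).1, (hT j hj).2⟩
      · rw [Finset.card_insert_of_notMem hiT, hcard, List.countP_cons, if_pos hb.1]
        omega
      · have hmark : (Ctl.mk' seen centre k).mark (rowEntry r μ v i) =
            ⟨μ i || (decide (i = v) && centre) || decide (i ∈ insert i T), decide (i ≤ v)⟩ := by
          obtain ⟨hb, hk1⟩ := hb
          simp only [Ctl.mark, Ctl.mk', rowEntry, hb, hk1]
          simp
        have hmap : L.map (fun j => (⟨μ j || (decide (j = v) && centre) || decide (j ∈ insert i T),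
              decide (j ≤ v)⟩ : Mark)) =
            L.map fun j => ⟨μ j || (decide (j = v) && centre) || decide (j ∈ T),
              decide (j ≤ v)⟩ := by
          refine List.map_congr_left fun j hj => ?_
          have : j ≠ i := by rintro rfl; exact hL.1 hj
          simp [this]
        rw [List.map_cons, List.map_cons, List.reverse_cons, hmap, ← hmark, List.append_assoc,
          List.singleton_append]
        exact (hstep.trans hrun).mono (by simp; omega)
    · obtain ⟨T, hT, hcard, hrun⟩ := ih hL.2 k hk
        ((Ctl.mk' seen centre k).mark (rowEntry r μ v i) :: marks)
      have hb' : ((r i && !μ i) && decide (1 ≤ k)) = false := by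
        rw [Bool.eq_false_iff]
        intro h
        rw [Bool.and_eq_true, decide_eq_true_iff] at h
        exact hb h
      have hctl : (Ctl.mk' seen centre k).backward (rowEntry r μ v i) = Ctl.mk' seen centre k := by
        simp only [Ctl.backward, Ctl.mk', rowEntry, hb', cond_false]
      rw [hctl] at hstep
      have hiT : i ∉ T := fun h => hL.1 (hT i h).1
      refine ⟨T, fun j hj => ⟨List.mem_cons_of_mem _ (hT j hj).1, (hT j hj).2⟩, ?_, ?_⟩
      · rw [hcard, List.countP_cons]
        by_cases h : (r i && !μ i) = true
        · have : k = 0 := by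
            by_contra hk0
            exact hb ⟨h, by omega⟩
          simp [this]
        · simp only [h, Bool.false_eq_true, if_false, add_zero]
      · have hmark : (Ctl.mk' seen centre k).mark (rowEntry r μ v i) =
            ⟨μ i || (decide (i = v) && centre) || decide (i ∈ T), decide (i ≤ v)⟩ := by
          simp only [Ctl.mark, Ctl.mk', rowEntry, hb', hiT, decide_false]
        rw [List.map_cons, List.map_cons, List.reverse_cons, ← hmark, List.append_assoc,
          List.singleton_append]
        exact (hstep.trans hrun).mono (by simp; omega)

/-- The row of `v` in the adjacency matrix, as it is written on the input stack. -/
def rowCode (r : Fin n → Bool) : List (Option Bool) :=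
  (List.finRange n).map (fun i => some (r i)) ++ [none]

/-- The effect of processing one row: if the current vertex is uncovered and has two uncovered
neighbours, then it is covered together with two of them. -/
lemma run_row (r μ : Fin n → Bool) (v : Fin n) (inp : List (Option Bool)) (out : List Bool) (z : ℤ)
    (marks : List Mark)
    (hm : marks = (List.finRange n).map (fun i => ⟨μ i, decide (i < v)⟩) ∨
      marks = [] ∧ ∀ i, (⟨μ i, decide (i < v)⟩ : Mark) = Mark.fresh)
    (cnt₁ cnt₂ : List Unit) :
    ∃ (T : Finset (Fin n)) (b : Bool),
      (∀ i ∈ T, r i = true ∧ μ i = false) ∧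
      (b = true → μ v = false ∧ T.card = 2) ∧
      (b = false → T = ∅ ∧
        (μ v = false → ∀ i j, r i = true → r j = true → μ i = false → μ j = false → i = j)) ∧
      RunsIn (config .forward Ctl.init (rowCode r ++ inp) out (unary z) marks [] cnt₁ cnt₂)
        (config .forward Ctl.init inp out (unary (z + bitSum ((List.finRange n).map r)))
          ((List.finRange n).map fun i =>
            ⟨μ i || (decide (i = v) && b) || decide (i ∈ T), decide (i ≤ v)⟩) []
          (if b then () :: cnt₁ else cnt₁) (if b then () :: cnt₂ else cnt₂)) (2 * n + 2) := by
  obtain ⟨seen, hf⟩ := run_forward_row r μ v (List.finRange n) (List.pairwise_lt_finRange n)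
    (fun h => absurd (List.mem_finRange v) h) false false (by simp) 0 (none :: inp) out z marks
    (hm.imp_right fun h => ⟨h.1, fun i _ => h.2 i⟩) [] cnt₁ cnt₂
  simp only [List.mem_finRange, decide_true, Bool.true_and, Bool.false_or, zero_add,
    List.append_nil, List.length_finRange] at hf
  set f := (List.finRange n).countP fun i => r i && !μ i with hfdef
  have hturn := step_forward_end (Ctl.mk' seen (!μ v) f) inp out
    (unary (z + bitSum ((List.finRange n).map r))) []
    ((List.finRange n).map (rowEntry r μ v)).reverse cnt₁ cnt₂
  have hinit : (Ctl.mk' false false 0) = Ctl.init := rfl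
  rw [hinit] at hf
  have hcode : rowCode r ++ inp = (List.finRange n).map (fun i => some (r i)) ++ none :: inp := by
    simp [rowCode]
  -- The greedy test. If it fails, `Ctl.turn` resets the counter to zero and the backward pass
  -- covers nothing.
  set b : Bool := (!μ v) && decide (2 ≤ f) with hb
  have hb' : ((Ctl.mk' seen (!μ v) f).centre && (Ctl.mk' seen (!μ v) f).two) = b := rfl
  have hturn' : (Ctl.mk' seen (!μ v) f).turn = Ctl.mk' b b (if b then 2 else 0) := by
    simp only [Ctl.turn, hb']
    cases b <;> rfl
  rw [hturn', hb'] at hturn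
  rw [← List.map_reverse] at hf hturn
  obtain ⟨T, hT, hcard, hback⟩ := run_backward_row r μ v (List.finRange n).reverse
    (List.nodup_reverse.2 (List.nodup_finRange n)) b b (if b then 2 else 0) (by cases b <;> simp)
    inp out (unary (z + bitSum ((List.finRange n).map r))) [] (if b then () :: cnt₁ else cnt₁)
    (if b then () :: cnt₂ else cnt₂)
  rw [List.countP_reverse, ← hfdef] at hcard
  refine ⟨T, b, fun i hi => (hT i hi).2, ?_, ?_, ?_⟩
  · intro h
    rw [h] at hcard hb
    have h2 := hb.symm
    simp only [Bool.and_eq_true, Bool.not_eq_true', decide_eq_true_eq] at h2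
    refine ⟨h2.1, ?_⟩
    rw [hcard]
    simp only [if_true]
    omega
  · intro h
    rw [h] at hcard hb
    refine ⟨by simpa using hcard, fun hv i j hi hj hμi hμj => ?_⟩
    have h2 : f < 2 := by
      by_contra h2
      rw [hv] at hb
      simp at hb
      omega
    by_contra hij
    have hsub : ({i, j} : Finset (Fin n)).card ≤ f := by
      have : f = (Finset.univ.filter fun i => (r i && !μ i) = true).card := by
        rw [hfdef, List.countP_eq_length_filter, ← List.toFinset_card_of_nodup
          ((List.nodup_finRange n).filter _)]
        congr 1
        ext i
        simp
      rw [this]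
      refine Finset.card_le_card fun a ha => ?_
      rcases Finset.mem_insert.1 ha with rfl | ha
      · simp [hi, hμi]
      · rw [Finset.mem_singleton] at ha
        subst ha
        simp [hj, hμj]
    rw [Finset.card_pair hij] at hsub
    omega
  · rw [hcode]
    have := (hf.trans hturn).trans hback
    rw [List.map_reverse, List.reverse_reverse, List.append_nil] at this
    exact this.mono (by simp; omega)

/-- The situation after the first `k` rows of the adjacency matrix `a` of `G` have been read. -/
lemma run_rows (G : SimpleGraph (Fin n)) (a : Fin n → Fin n → Bool)
    (ha : ∀ i j, a i j = true ↔ G.Adj i j) (k : ℕ) (hk : k ≤ n) :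
    ∃ (P : Finset (Finset (Fin n))) (μ : Fin n → Bool) (z : ℤ) (marks : List Mark),
      IsPathPacking G P ∧ P.card ≤ k ∧ (∀ i, μ i = true ↔ i ∈ P.biUnion id) ∧
      (∀ v : Fin n, v.val < k → μ v = false → ∀ i j, G.Adj v i → G.Adj v j →
        μ i = false → μ j = false → i = j) ∧
      z = (((List.finRange n).take k).map fun i => bitSum ((List.finRange n).map (a i))).sum ∧
      z.natAbs ≤ k * n ∧
      (marks = (List.finRange n).map (fun i => ⟨μ i, decide (i.val < k)⟩) ∨
        marks = [] ∧ k = 0) ∧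
      RunsIn (config .forward Ctl.init ((List.finRange n).flatMap fun i => rowCode (a i)) [] [] []
          [] [] [])
        (config .forward Ctl.init (((List.finRange n).drop k).flatMap fun i => rowCode (a i)) []
          (unary z) marks [] (List.replicate P.card ()) (List.replicate P.card ()))
        (k * (2 * n + 2)) := by
  classical
  induction k with
  | zero =>
    refine ⟨∅, fun _ => false, 0, [], ⟨by simp, by simp⟩, by simp, by simp, by simp, by simp,
      by simp, by simp, ?_⟩
    simpa [unary] using RunsIn.refl _
  | succ k ih =>
    obtain ⟨P, μ, z, marks, hP, hcard, hμ, hdone, hz, hzle, hmarks, hrun⟩ := ih (by omega)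
    set v : Fin n := ⟨k, by omega⟩ with hv
    have hmarks' : marks = (List.finRange n).map (fun i => ⟨μ i, decide (i < v)⟩) ∨
        marks = [] ∧ ∀ i, (⟨μ i, decide (i < v)⟩ : Mark) = Mark.fresh := by
      rcases hmarks with h | ⟨h, rfl⟩
      · exact Or.inl h
      · refine Or.inr ⟨h, fun i => ?_⟩
        have hP0 : P = ∅ := by simpa using hcard
        have : μ i = false := by
          rw [Bool.eq_false_iff, Ne, hμ, hP0]; simp
        have hlt : ¬ i < v := by simp [hv, Fin.lt_def]
        simp [this, hlt, Mark.fresh]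
    have hdrop : (List.finRange n).drop k = v :: (List.finRange n).drop (k + 1) := by
      rw [List.drop_eq_getElem_cons (by simpa using hk)]
      simp [hv]
    obtain ⟨T, b, hT, hbt, hbf, hrow⟩ := run_row (a v) μ v
      (((List.finRange n).drop (k + 1)).flatMap fun i => rowCode (a i)) [] z marks hmarks'
      (List.replicate P.card ()) (List.replicate P.card ())
    rw [hdrop, List.flatMap_cons] at hrun
    have hrun' := hrun.trans hrow
    have hvT : v ∉ T := fun h => by
      have := (ha v v).1 (hT v h).1
      exact G.irrefl this
    have hz' : z + bitSum ((List.finRange n).map (a v)) =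
        (((List.finRange n).take (k + 1)).map fun i =>
          bitSum ((List.finRange n).map (a i))).sum := by
      rw [List.take_add_one, List.map_append, List.sum_append, ← hz]
      have : (List.finRange n)[k]? = some v := by
        rw [List.getElem?_eq_getElem (by simpa using hk)]; simp [hv]
      simp [this]
    have hz'le : (z + bitSum ((List.finRange n).map (a v))).natAbs ≤ (k + 1) * n := by
      have h1 := bitSum_natAbs_le ((List.finRange n).map (a v))
      rw [List.length_map, List.length_finRange] at h1
      have h2 := Int.natAbs_add_le z (bitSum ((List.finRange n).map (a v)))
      rw [Nat.add_mul]
      omega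
    have hdec : ∀ i : Fin n, decide (i ≤ v) = decide (i.val < k + 1) := by
      intro i
      simp [hv, Fin.le_def]
    have htime : k * (2 * n + 2) + (2 * n + 2) = (k + 1) * (2 * n + 2) := by ring
    rw [htime] at hrun'
    cases b with
    | false =>
      obtain ⟨rfl, hfree⟩ := hbf rfl
      refine ⟨P, μ, _, _, hP, by omega, hμ, ?_, hz', hz'le, Or.inl rfl, ?_⟩
      -- Rows treated earlier stay settled because the covered set only grows; for the current row,
      -- failure of the greedy test is exactly the claim.
      · intro w hw hμw i j hi hj
        rcases Nat.lt_succ_iff_lt_or_eq.1 hw with h | h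
        · exact hdone w h hμw i j hi hj
        · obtain rfl : w = v := Fin.ext h
          exact hfree hμw i j ((ha _ _).2 hi) ((ha _ _).2 hj)
      · simpa [hdec] using hrun'
    | true =>
      obtain ⟨hμv, hT2⟩ := hbt rfl
      obtain ⟨x, y, hxy, rfl⟩ := Finset.card_eq_two.1 hT2
      have hx := hT x (by simp)
      have hy := hT y (by simp)
      have hnew : ∀ i ∈ ({x, v, y} : Finset (Fin n)), μ i = false := by
        intro i hi
        simp only [Finset.mem_insert, Finset.mem_singleton] at hi
        rcases hi with rfl | rfl | rfl
        exacts [hx.2, hμv, hy.2]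
      have hdisj : ∀ p ∈ P, Disjoint p {x, v, y} := by
        intro p hp
        rw [Finset.disjoint_right]
        intro i hi hip
        have h1 := hnew i hi
        rw [(hμ i).2 (Finset.mem_biUnion.2 ⟨p, hp, hip⟩)] at h1
        exact absurd h1 (by simp)
      have hnotMem : ({x, v, y} : Finset (Fin n)) ∉ P := by
        intro h
        have := Finset.disjoint_left.1 (hdisj _ h) (Finset.mem_insert_self x _)
        exact this (Finset.mem_insert_self x _)
      simp only [hdec, if_true] at hrun'
      have hcard' : (insert {x, v, y} P).card = P.card + 1 :=
        Finset.card_insert_of_notMem hnotMem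
      refine ⟨insert {x, v, y} P,
        fun i => μ i || (decide (i = v) && true) || decide (i ∈ ({x, y} : Finset (Fin n))), _, _,
        ⟨?_, ?_⟩, ?_, ?_, ?_, hz', hz'le, Or.inl rfl, ?_⟩
      · rw [Finset.coe_insert, Set.pairwiseDisjoint_insert]
        exact ⟨hP.disjoint, fun p hp _ => (hdisj p hp).symm⟩
      · intro p hp
        rcases Finset.mem_insert.1 hp with rfl | hp
        · exact ⟨x, v, y, (ha _ _).1 hx.1, (ha _ _).1 hy.1, hxy, rfl⟩
        · exact hP.path p hp
      · rw [hcard']; omega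
      · intro i
        rw [Finset.biUnion_insert, Finset.mem_union, ← hμ]
        simp only [id, Finset.mem_insert, Finset.mem_singleton, Bool.or_eq_true, Bool.and_true,
          decide_eq_true_eq]
        constructor
        · rintro ((h | h) | h | h) <;> simp only [h, true_or, or_true]
        · rintro ((h | h | h) | h) <;> simp only [h, true_or, or_true]
      · intro w hw hμw i j hi hj hμi hμj
        simp only [Bool.or_eq_false_iff, Bool.and_true, decide_eq_false_iff_not] at hμw hμi hμj
        rcases Nat.lt_succ_iff_lt_or_eq.1 hw with h | h
        · exact hdone w h hμw.1.1 i j hi hj hμi.1.1 hμj.1.1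
        · exact absurd (Fin.ext h) hμw.1.2
      · rw [hcard', List.replicate_succ]
        exact hrun'

/-- The run of the machine on an adjacency matrix. -/
lemma run_matrix (G : SimpleGraph (Fin n)) (a : Fin n → Fin n → Bool)
    (ha : ∀ i j, a i j = true ↔ G.Adj i j) :
    ∃ P : Finset (Finset (Fin n)), IsPathPacking G P ∧
      IsDissociation G {v | v ∉ P.biUnion id} ∧
      RunsIn (config .forward Ctl.init ((List.finRange n).flatMap fun i => rowCode (a i)) [] [] []
          [] [] [])
        ⟨none, Var.ofCtl Ctl.init, contents []
          (encodeNatPair (if 0 < ∑ i, ∑ j, (if a i j then (1 : ℤ) else -1) ∨ P.card = 0 then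
            (n, (n + 1) / 2) else (3 * P.card, P.card))) [] [] [] [] []⟩
        (10 * (n * (n + 1)) + 10) := by
  obtain ⟨P, μ, z, marks, hP, hcard, hμ, hdone, hz, hzle, hmarks, hrun⟩ :=
    run_rows G a ha n le_rfl
  have hz' : z = ∑ i, ∑ j, (if a i j then (1 : ℤ) else -1) := by
    rw [hz, List.take_of_length_le (by simp)]
    simp only [bitSum, List.map_map, Function.comp_def, ← Fin.sum_univ_def]
  have hlen : marks.length = n := by
    rcases hmarks with rfl | ⟨rfl, rfl⟩ <;> simp
  have henc : ∀ a b : ℕ, encodeNatPair (a, b) =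
      List.replicate a true ++ false :: (List.replicate b true ++ []) := by
    have hun : ∀ a : ℕ, Computability.unaryEncodeNat a = List.replicate a true := by
      intro a
      induction a with
      | zero => rfl
      | succ a ih => rw [Computability.unaryEncodeNat, ih, List.replicate_succ]
    intro a b
    simp [encodeNatPair, hun]
  refine ⟨P, hP, ?_, ?_⟩
  · have hfree : ∀ v, v ∉ P.biUnion id → μ v = false := fun v hv => by
      rwa [Bool.eq_false_iff, Ne, hμ]
    exact fun v hv u hu w hw hvu hvw =>
      hdone v v.2 (hfree v hv) u w hvu hvw (hfree u hu) (hfree w hw)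
  rw [← hz']
  rw [List.drop_of_length_le (by simp), List.flatMap_nil] at hrun
  have h₁ := (hrun.trans (step_forward_nil ..)).trans (step_decide ..)
  have hcond : ((unary z).head? = some true ∨ List.replicate P.card () = []) ↔
      (0 < z ∨ P.card = 0) := by
    rw [unary_head?_eq]; simp
  -- The balance has absolute value at most n², the other stacks have height at most n.
  have hclean : ∀ l : List Unit, ∀ m : List Mark, l.length ≤ n → m.length ≤ n → ∀ out,
      RunsIn (config .clean Ctl.init [] out (unary z) m [] l l)
        ⟨none, Var.ofCtl Ctl.init, contents [] out [] [] [] [] []⟩ (n * n + n + 1) := by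
    intro l m hl hm out
    refine run_clean _ _ _ _ _ _ ?_ ?_ ?_ ?_
    · rw [unary_length]; omega
    all_goals nlinarith
  by_cases h : 0 < z ∨ P.card = 0
  · rw [if_pos h, henc]
    rw [if_pos (hcond.2 h)] at h₁
    have h₂ := h₁.trans (run_halves _ _ _ _ _ _ _ n false hlen)
    have h₃ := h₂.trans (run_whole ..)
    have h₄ := h₃.trans (hclean _ _ (by simpa using hcard) (by simp) _)
    simp only [List.append_nil, List.length_replicate, Bool.false_eq_true, if_false] at h₄ ⊢
    exact h₄.mono (by nlinarith)
  · rw [if_neg h, henc]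
    rw [if_neg (mt hcond.1 h)] at h₁
    have h₂ := h₁.trans (run_single ..)
    have h₃ := h₂.trans (run_triple ..)
    have h₄ := h₃.trans (hclean _ _ (by simp) hlen.le _)
    simp only [List.append_nil, List.length_replicate] at h₄ ⊢
    exact h₄.mono (by nlinarith)

end Machine

/-! ### Polynomial-time computability -/

/-- A function is computed in polynomial time if its values are the outputs of the machine. -/
lemma isPolyTime_of_runsIn (f : FinGraph → ℕ × ℕ)
    (hf : ∀ x, Machine.RunsIn
      (Machine.config .forward Machine.Ctl.init (encodeGraph x) [] [] [] [] [] [])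
      ⟨none, Machine.Var.ofCtl Machine.Ctl.init,
        Machine.contents [] (encodeNatPair (f x)) [] [] [] [] []⟩
      (10 * (encodeGraph x).length + 10)) :
    IsPolyTime f := by
  refine ⟨⟨⟨Machine.machine, Equiv.refl _, Equiv.refl _⟩, 10 * Polynomial.X + 10, fun x => ?_⟩⟩
  have hinit : Turing.initList Machine.machine (encodeGraph x) =
      Machine.config .forward Machine.Ctl.init (encodeGraph x) [] [] [] [] [] [] := by
    refine congrArg (Turing.TM2.Cfg.mk _ _) (funext fun k => ?_)
    cases k <;> rfl
  have hhalt : Turing.haltList Machine.machine (encodeNatPair (f x)) =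
      ⟨none, Machine.Var.ofCtl Machine.Ctl.init,
        Machine.contents [] (encodeNatPair (f x)) [] [] [] [] []⟩ := by
    refine congrArg (Turing.TM2.Cfg.mk _ _) (funext fun k => ?_)
    cases k <;> rfl
  have hex : ∃ s, s ≤ (10 * Polynomial.X + 10 : Polynomial ℕ).eval (encodeGraph x).length ∧
      (flip bind Machine.machine.step)^[s]
        (some (Turing.initList Machine.machine (encodeGraph x))) =
      some (Turing.haltList Machine.machine (encodeNatPair (f x))) := by
    obtain ⟨s, hs, h⟩ := hf x
    refine ⟨s, by simpa using hs, ?_⟩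
    rw [hinit, hhalt]
    exact h
  -- The number of steps is data in the structure to be built, while `RunsIn` merely asserts that it
  -- exists.
  have hs := Classical.choose_spec hex
  refine ⟨⟨Classical.choose hex, ?_⟩, hs.1⟩
  have h1 : ∀ l : List (Option Bool), List.map (Equiv.refl (Option Bool)).invFun l = l :=
    fun l => List.map_id l
  have h2 : ∀ l : List Bool, List.map (Equiv.refl Bool).invFun l = l := fun l => List.map_id l
  have e1 := congrArg (fun l => (flip bind Machine.machine.step)^[Classical.choose hex]
    (some (Turing.initList Machine.machine l))) (h1 (encodeGraph x))
  have e2 := congrArg (fun l => some (Turing.haltList Machine.machine l)) (h2 (encodeNatPair (f x)))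
  exact e1.trans (hs.2.trans e2.symm)

open Classical in
/-- The values that the machine computes. -/
lemma exists_isPolyTime :
    ∃ f : FinGraph → ℕ × ℕ, IsPolyTime f ∧ ∀ x : FinGraph,
      ∃ P : Finset (Finset (Fin x.1)), IsPathPacking x.2 P ∧
        IsDissociation x.2 {v | v ∉ P.biUnion id} ∧
        f x = if 0 < ∑ i, ∑ j, (if x.2.Adj i j then (1 : ℤ) else -1) ∨ P.card = 0 then
          (x.1, (x.1 + 1) / 2) else (3 * P.card, P.card) := by
  have key := fun x : FinGraph => Machine.run_matrix x.2 (fun i j => decide (x.2.Adj i j))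
    (fun i j => decide_eq_true_iff)
  choose P hP hX hrun using key
  refine ⟨fun x => if 0 < ∑ i, ∑ j, (if x.2.Adj i j then (1 : ℤ) else -1) ∨ (P x).card = 0 then
          (x.1, (x.1 + 1) / 2) else (3 * (P x).card, (P x).card), isPolyTime_of_runsIn _ fun x => ?_,
    fun x => ⟨P x, ?_, ?_, rfl⟩⟩
  · have hlen : (encodeGraph x).length = x.1 * (x.1 + 1) := by
      simp [encodeGraph, List.length_flatMap]
    have := hrun x
    simp only [decide_eq_true_eq] at this
    rw [hlen]
    exact this
  · convert hP x
  · convert hX x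

open Finset

/-! ### The order of a scramble -/

section Cuts

variable {V : Type*}

lemma exists_adj_of_connected {G : SimpleGraph V} {H : G.Subgraph} (hH : H.Connected) {U : Set V}
    {x y : V} (hx : x ∈ H.verts) (hy : y ∈ H.verts) (hxU : x ∈ U) (hyU : y ∉ U) :
    ∃ a b, H.Adj a b ∧ a ∈ U ∧ b ∉ U := by
  obtain ⟨p⟩ := hH ⟨x, hx⟩ ⟨y, hy⟩
  obtain ⟨d, -, h1, h2⟩ := p.exists_boundary_dart (Subtype.val ⁻¹' U) hxU hyU
  exact ⟨d.fst, d.snd, d.adj, h1, h2⟩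

variable [Fintype V]

lemma outdegree_eq_sum [DecidableEq V] (G : SimpleGraph V) [DecidableRel G.Adj] (A : Finset V) :
    outdegree G A = ∑ x ∈ A, #(G.neighborFinset x \ A) := by
  have : {p : V × V | p.1 ∈ (A : Set V) ∧ p.2 ∉ (A : Set V) ∧ G.Adj p.1 p.2} =
      ((A.sigma fun x => G.neighborFinset x \ A).map (Equiv.sigmaEquivProd V V).toEmbedding :
        Finset (V × V)) := by
    ext ⟨x, y⟩
    simp
    tauto
  rw [outdegree, this, Set.ncard_coe_finset, card_map, card_sigma]

/-- An egg-cut contains all boundary edges of the component around one of the two separated eggs, so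
only boundaries of vertex sets matter. -/
lemma le_eggCutNumber {G : SimpleGraph V} {S : Set G.Subgraph} {m : ℕ}
    (h : ∀ A : Finset V, (∃ H ∈ S, H.verts ⊆ A) → (∃ H ∈ S, H.verts ⊆ (A : Set V)ᶜ) →
      m ≤ outdegree G A) : (m : ℕ∞) ≤ eggCutNumber G S := by
  classical
  refine le_iInf₂ fun W hW => ?_
  obtain ⟨-, C₁, C₂, hC, ⟨H₁, hS₁, h₁⟩, ⟨H₂, hS₂, h₂⟩⟩ := hW
  have hA := h C₁.supp.toFinset ⟨H₁, hS₁, by simpa using h₁⟩ ⟨H₂, hS₂, fun v hv => ?_⟩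
  · refine Nat.cast_le.2 (hA.trans ?_)
    rw [outdegree, ← Set.ncard_coe_finset W]
    refine Set.ncard_le_ncard_of_injOn (fun p => s(p.1, p.2)) ?_ ?_ W.finite_toSet
    · rintro ⟨x, y⟩ ⟨hx, hy, hxy⟩
      simp only [Set.coe_toFinset, SimpleGraph.ConnectedComponent.mem_supp_iff] at hx hy
      by_contra hW
      refine hy ?_
      rw [← hx, SimpleGraph.ConnectedComponent.eq]
      exact ((SimpleGraph.deleteEdges_adj.2 ⟨hxy, hW⟩).symm).reachable
    · rintro ⟨x, y⟩ ⟨hx, hy, -⟩ ⟨x', y'⟩ ⟨hx', hy', -⟩ he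
      rcases Sym2.eq_iff.1 he with ⟨h1, h2⟩ | ⟨h1, h2⟩
      · exact Prod.ext h1 h2
      · simp only at h1 hx hy'
        exact absurd (h1 ▸ hx) hy'
  · have hv₂ := h₂ hv
    simp only [Set.coe_toFinset, Set.mem_compl_iff,
      SimpleGraph.ConnectedComponent.mem_supp_iff] at hv₂ ⊢
    exact fun hv₁ => hC (hv₁.symm.trans hv₂)

/-- The boundary of `A` is an egg-cut: an egg on one side uses none of its edges and so stays in one
component, and no walk changes sides after the deletion. -/
lemma eggCutNumber_le {G : SimpleGraph V} {S : Set G.Subgraph} (hS : ∀ H ∈ S, H.Connected)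
    (A : Finset V) (h₁ : ∃ H ∈ S, H.verts ⊆ A) (h₂ : ∃ H ∈ S, H.verts ⊆ (A : Set V)ᶜ) :
    eggCutNumber G S ≤ outdegree G A := by
  classical
  set B : Finset (V × V) := univ.filter fun p => p.1 ∈ A ∧ p.2 ∉ A ∧ G.Adj p.1 p.2 with hB
  have hcard : outdegree G A = #B := by
    rw [outdegree, ← Set.ncard_coe_finset]
    simp [hB]
  set W : Finset (Sym2 V) := B.image fun p => s(p.1, p.2) with hW
  have hmem : ∀ x y, G.Adj x y → (x ∈ A ↔ y ∉ A) → s(x, y) ∈ W := by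
    intro x y hxy h
    by_cases hx : x ∈ A
    · exact mem_image.2 ⟨(x, y), by simp [hB, hx, h.1 hx, hxy], rfl⟩
    · refine mem_image.2 ⟨(y, x), ?_, Sym2.eq_swap⟩
      have : y ∈ A := by
        by_contra hy
        exact hx (h.2 hy)
      simp [hB, hx, this, hxy.symm]
  have hmem' : ∀ x y, s(x, y) ∈ W → (x ∈ A ↔ y ∉ A) := by
    intro x y h
    obtain ⟨⟨a, b⟩, hab, he⟩ := mem_image.1 h
    simp only [hB, mem_filter, mem_univ, true_and] at hab
    rcases Sym2.eq_iff.1 he with ⟨rfl, rfl⟩ | ⟨rfl, rfl⟩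
    · simp [hab.1, hab.2.1]
    · simp [hab.1, hab.2.1]
  have hside : ∀ {x y}, (G.deleteEdges (W : Set (Sym2 V))).Reachable x y → (x ∈ A ↔ y ∈ A) := by
    rintro x y ⟨p⟩
    induction p with
    | nil => rfl
    | @cons u v w huv p ih =>
      rw [← ih]
      obtain ⟨huv, hn⟩ := SimpleGraph.deleteEdges_adj.1 huv
      by_contra hne
      exact hn (mem_coe.2 (hmem _ _ huv (by tauto)))
  have hegg : ∀ H ∈ S, ∀ x ∈ H.verts, (∀ y ∈ H.verts, x ∈ A ↔ y ∈ A) → H.verts ⊆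
      ((G.deleteEdges (W : Set (Sym2 V))).connectedComponentMk x).supp := by
    intro H hH x hx hxy y hy
    rw [SimpleGraph.ConnectedComponent.mem_supp_iff, SimpleGraph.ConnectedComponent.eq]
    let φ : H.coe →g G.deleteEdges (W : Set (Sym2 V)) :=
      ⟨Subtype.val, fun {a b} hab => SimpleGraph.deleteEdges_adj.2 ⟨H.adj_sub hab, fun h => by
        have h1 := hmem' _ _ (mem_coe.1 h)
        have h2 := hxy a a.2
        have h3 := hxy b b.2
        tauto⟩⟩
    exact (hS H hH ⟨y, hy⟩ ⟨x, hx⟩).map φ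
  obtain ⟨H₁, hH₁, hs₁⟩ := h₁
  obtain ⟨H₂, hH₂, hs₂⟩ := h₂
  obtain ⟨x₁, hx₁⟩ := (hS H₁ hH₁).nonempty
  obtain ⟨x₂, hx₂⟩ := (hS H₂ hH₂).nonempty
  have hx₁A : x₁ ∈ A := hs₁ hx₁
  have hx₂A : x₂ ∉ A := hs₂ hx₂
  refine (iInf₂_le W ⟨?_, _, _, ?_, ⟨H₁, hH₁, hegg H₁ hH₁ x₁ hx₁ fun y hy => ?_⟩,
    ⟨H₂, hH₂, hegg H₂ hH₂ x₂ hx₂ fun y hy => ?_⟩⟩).trans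
    (Nat.cast_le.2 (hcard ▸ card_image_le))
  · intro e he
    obtain ⟨p, hp, rfl⟩ := mem_image.1 (mem_coe.1 he)
    simp only [hB, mem_filter] at hp
    exact hp.2.2.2
  · intro h
    rw [SimpleGraph.ConnectedComponent.eq] at h
    exact hx₂A ((hside h).1 hx₁A)
  · exact ⟨fun _ => hs₁ hy, fun _ => hx₁A⟩
  · exact ⟨fun h => absurd h hx₂A, fun h => absurd h (hs₂ hy)⟩

end Cuts

/-! ### The scramble number is at most the gonality -/

section Fire

variable {V : Type*} [Fintype V] (G : SimpleGraph V)

lemma fire_fire (D σ τ : V → ℤ) : fire G (fire G D σ) τ = fire G D (σ + τ) := by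
  funext w
  simp only [fire, add_assoc, ← sum_add_distrib]
  congr 1
  refine sum_congr rfl fun u _ => ?_
  split_ifs
  · simp only [Pi.add_apply]; ring
  · rfl

lemma fire_add_left (D E σ : V → ℤ) (w : V) : fire G (D + E) σ w = fire G D σ w + E w := by
  simp only [fire, Pi.add_apply]; ring

lemma sum_fire (D σ : V → ℤ) : ∑ w, fire G D σ w = ∑ w, D w := by
  classical
  simp only [fire, sum_add_distrib, add_eq_left]
  have h : ∀ w u, (if G.Adj w u then σ u - σ w else 0) =
      (if G.Adj w u then σ u else 0) - if G.Adj w u then σ w else 0 := by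
    intro w u
    split_ifs <;> simp
  simp only [h, sum_sub_distrib]
  rw [sub_eq_zero, sum_comm]
  exact sum_congr rfl fun u _ => sum_congr rfl fun w _ => by rw [G.adj_comm]

lemma hasPositiveRank_one : HasPositiveRank G (fun _ => 1) := by
  classical
  refine fun v => ⟨0, fun w => ?_⟩
  have : (Pi.single v 1 : V → ℤ) w ≤ 1 := by
    by_cases h : w = v
    · subst h; simp
    · simp [Pi.single_eq_of_ne h]
  simp [fire]
  convert this

/-- The infimum is attained because the all-ones divisor makes the set nonempty. -/
lemma exists_hasPositiveRank_gon : ∃ D : V → ℤ, ∑ v, D v = (gon G : ℤ) ∧ HasPositiveRank G D := by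
  have : (gon G) ∈ {d : ℕ | ∃ D : V → ℤ, ∑ v, D v = (d : ℤ) ∧ HasPositiveRank G D} :=
    Nat.sInf_mem ⟨Fintype.card V, fun _ => 1, by simp, hasPositiveRank_one G⟩
  exact this

lemma gon_le {d : ℕ} {D : V → ℤ} (hD : ∑ v, D v = (d : ℤ)) (h : HasPositiveRank G D) :
    gon G ≤ d :=
  Nat.sInf_le ⟨D, hD, h⟩

lemma gon_le_card : gon G ≤ Fintype.card V :=
  gon_le G (by simp) (hasPositiveRank_one G)

/-- If firing `σ` leads from an effective divisor to an effective divisor, then so does every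
truncation of `σ`. -/
lemma fire_max_nonneg {D σ : V → ℤ} (hD : ∀ w, 0 ≤ D w) (hσ : ∀ w, 0 ≤ fire G D σ w) (c : ℤ)
    (w : V) : 0 ≤ fire G D (fun u => max (σ u) c) w := by
  -- If σ w ≥ c, truncation leaves `w` alone and only raises its neighbours, so `w` gets at least
  -- what σ gives it. Otherwise `w` fires least of all and loses nothing.
  rcases le_total c (σ w) with h | h
  · refine (hσ w).trans (add_le_add_right (sum_le_sum fun u _ => ?_) _)
    split_ifs
    · simp only [max_eq_left h]; linarith [le_max_left (σ u) c]
    · rfl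
  · refine add_nonneg (hD w) (sum_nonneg fun u _ => ?_)
    split_ifs
    · simp only [max_eq_right h]; linarith [le_max_right (σ u) c]
    · rfl

/-- Lowering the threshold from c to c - 1 is the same as firing the level set {σ ≥ c} once, since
firing all vertices equally changes nothing. -/
lemma fire_max_pred [DecidableEq V] [DecidableRel G.Adj] (D σ : V → ℤ) (c : ℤ) (w : V) :
    fire G D (fun u => max (σ u) (c - 1)) w = fire G D (fun u => max (σ u) c) w +
      if c ≤ σ w then -(#(G.neighborFinset w \ univ.filter fun u => c ≤ σ u) : ℤ)
        else #(G.neighborFinset w ∩ univ.filter fun u => c ≤ σ u) := by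
  have key : ∀ u, max (σ u) (c - 1) = max (σ u) c - (if c ≤ σ u then 0 else 1) := by
    intro u
    split_ifs with h
    · rw [max_eq_left h, max_eq_left (by linarith), sub_zero]
    · rw [max_eq_right (by omega), max_eq_right (by omega)]
  have hterm : ∀ u, (if G.Adj w u then max (σ u) (c - 1) - max (σ w) (c - 1) else 0) =
      (if G.Adj w u then max (σ u) c - max (σ w) c else 0) +
      if G.Adj w u then (if c ≤ σ w then 0 else 1) - (if c ≤ σ u then 0 else 1) else 0 := by
    intro u
    rw [key, key]
    split_ifs <;> ring
  have hN : G.neighborFinset w = univ.filter fun u => G.Adj w u := by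
    ext u; simp
  have h1 : (fire G D (fun u => max (σ u) (c - 1)) w) =
      D w + ∑ u, if G.Adj w u then max (σ u) (c - 1) - max (σ w) (c - 1) else 0 := by
    simp only [fire]
  have h2 : (fire G D (fun u => max (σ u) c) w) =
      D w + ∑ u, if G.Adj w u then max (σ u) c - max (σ w) c else 0 := by
    simp only [fire]
  rw [h1, h2, sum_congr rfl fun u _ => hterm u, sum_add_distrib, add_assoc]
  congr 2
  split_ifs with h
  · rw [card_eq_sum_ones, Nat.cast_sum, ← sum_neg_distrib]
    have : G.neighborFinset w \ univ.filter (fun u => c ≤ σ u) =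
        univ.filter fun u => G.Adj w u ∧ ¬ c ≤ σ u := by
      ext u; simp
    rw [this, sum_filter]
    refine sum_congr rfl fun u _ => ?_
    by_cases h1 : G.Adj w u <;> by_cases h2 : c ≤ σ u <;> simp [h1, h2]
  · rw [card_eq_sum_ones, Nat.cast_sum]
    have : G.neighborFinset w ∩ univ.filter (fun u => c ≤ σ u) =
        univ.filter fun u => G.Adj w u ∧ c ≤ σ u := by
      ext u; simp
    rw [this, sum_filter]
    refine sum_congr rfl fun u _ => ?_
    by_cases h1 : G.Adj w u <;> by_cases h2 : c ≤ σ u <;> simp [h1, h2]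

/-- Either the chips of some equivalent effective divisor hit every egg, or a level set fired on the
way to a missed egg bounds an egg-cut with at most d edges. -/
lemma scrambleOrder_le {S : Set G.Subgraph} (hS : IsScramble G S) {D₀ : V → ℤ} {d : ℕ}
    (hd : ∑ v, D₀ v = (d : ℤ)) (hD₀ : HasPositiveRank G D₀) : scrambleOrder G S ≤ d := by
  classical
  set hits : (V → ℤ) → Set G.Subgraph := fun τ =>
    {H | H ∈ S ∧ ∃ v ∈ H.verts, 0 < fire G D₀ τ v} with hhits
  have heff : ∀ v, ∃ τ, (∀ w, 0 ≤ fire G D₀ τ w) ∧ 0 < fire G D₀ τ v := by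
    intro v
    obtain ⟨σ, hσ⟩ := hD₀ v
    have h : ∀ w, fire G D₀ σ w = fire G (D₀ - Pi.single v 1) σ w + (Pi.single v 1 : V → ℤ) w := by
      intro w
      rw [← fire_add_left, sub_add_cancel]
    refine ⟨σ, fun w => ?_, ?_⟩
    · rw [h]
      refine add_nonneg (by convert hσ w) ?_
      by_cases hw : w = v
      · subst hw; simp
      · simp [Pi.single_eq_of_ne hw]
    · rw [h, Pi.single_eq_same]
      have := hσ v
      have h' : 0 ≤ fire G (D₀ - Pi.single v 1) σ v := by convert this
      linarith
  obtain ⟨⟨H₀, hH₀⟩, hconn⟩ := hS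
  obtain ⟨v₀, -⟩ := (hconn H₀ hH₀).nonempty
  obtain ⟨τ, hτ, hmax⟩ : ∃ τ, (∀ w, 0 ≤ fire G D₀ τ w) ∧
      ∀ τ', (∀ w, 0 ≤ fire G D₀ τ' w) → hits τ ⊆ hits τ' → hits τ' ⊆ hits τ := by
    obtain ⟨τ₀, hτ₀, -⟩ := heff v₀
    obtain ⟨M, ⟨τ, hτ, rfl⟩, hM⟩ :=
      (Set.toFinite (hits '' {τ | ∀ w, 0 ≤ fire G D₀ τ w})).exists_maximal ⟨_, Set.mem_image_of_mem _ hτ₀⟩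
    exact ⟨τ, hτ, fun τ' hτ' h => hM (Set.mem_image_of_mem _ hτ') h⟩
  have hsum : ∀ τ, ∑ w, fire G D₀ τ w = (d : ℤ) := fun τ => by rw [sum_fire, hd]
  by_cases hall : ∀ H ∈ S, H ∈ hits τ
  · refine (min_le_left _ _).trans ((iInf₂_le (univ.filter fun v => 0 < fire G D₀ τ v)
      fun H hH => ?_).trans (Nat.cast_le.2 ?_))
    · obtain ⟨-, v, hv, hpos⟩ := hall H hH
      exact ⟨v, by simpa using hpos, hv⟩
    · rw [← Nat.cast_le (α := ℤ), ← hsum τ, card_eq_sum_ones, Nat.cast_sum, sum_filter]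
      refine sum_le_sum fun w _ => ?_
      have := hτ w
      split_ifs <;> push_cast <;> omega
  push Not at hall
  obtain ⟨H, hH, hHτ⟩ := hall
  obtain ⟨v, hv⟩ := (hconn H hH).nonempty
  obtain ⟨τ₁, hτ₁, hτ₁v⟩ := heff v
  set D := fire G D₀ τ with hD
  set σ := τ₁ - τ with hσ
  have hDσ : fire G D σ = fire G D₀ τ₁ := by rw [hD, fire_fire, hσ, add_sub_cancel]
  -- For large c this is τ up to a constant, hence gives the divisor D; at c = σ v it already has a
  -- chip on v.
  set T : ℤ → V → ℤ := fun c => τ + fun u => max (σ u) c with hT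
  have hTfire : ∀ c, fire G D₀ (T c) = fire G D (fun u => max (σ u) c) := by
    intro c
    rw [hD, fire_fire]
  have hTeff : ∀ c w, 0 ≤ fire G D₀ (T c) w := by
    intro c w
    rw [hTfire]
    exact fire_max_nonneg G hτ (by rw [hDσ]; exact hτ₁) c w
  have hvhit : H ∈ hits (T (σ v)) := by
    refine ⟨hH, v, hv, hτ₁v.trans_le ?_⟩
    rw [hTfire, ← hDσ]
    refine add_le_add_right (sum_le_sum fun u _ => ?_) _
    split_ifs
    · simp only [max_self]; linarith [le_max_left (σ u) (σ v)]
    · rfl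
  -- Such a c exists because otherwise all eggs of `hits τ` would still be hit at c = σ v, together
  -- with `H`, against maximality.
  obtain ⟨c, hc, hc₁, hc₂⟩ : ∃ c, σ v < c ∧ hits τ ⊆ hits (T c) ∧ ¬ hits τ ⊆ hits (T (c - 1)) := by
    by_contra hcon
    push Not at hcon
    obtain ⟨M, hM⟩ : ∃ M : ℕ, ∀ u, σ u ≤ σ v + M := by
      refine ⟨∑ u, (σ u - σ v).natAbs, fun u => ?_⟩
      have := single_le_sum (f := fun u => (σ u - σ v).natAbs) (fun _ _ => Nat.zero_le _)
        (mem_univ u)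
      have h2 : σ u - σ v ≤ (σ u - σ v).natAbs := Int.le_natAbs
      omega
    have hdown : ∀ k : ℕ, k ≤ M → hits τ ⊆ hits (T (σ v + M - k)) := by
      intro k
      induction k with
      | zero =>
        intro _
        have : fire G D₀ (T (σ v + M - (0 : ℕ))) = fire G D₀ τ := by
          rw [hTfire, ← hD]
          funext w
          have h1 : ∀ u, max (σ u) (σ v + M) = σ v + M := fun u => max_eq_right (hM u)
          simp [fire, h1]
        intro K hK
        obtain ⟨hKS, w, hw, hpos⟩ := hK
        exact ⟨hKS, w, hw, by rw [this]; exact hpos⟩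
      | succ k ih =>
        intro hk
        have := hcon (σ v + M - k) (by omega) (ih (by omega))
        rwa [show σ v + M - k - 1 = σ v + M - ((k + 1 : ℕ) : ℤ) by push_cast; ring] at this
    have h0 := hdown M le_rfl
    rw [add_sub_cancel_right] at h0
    exact hHτ (hmax _ (hTeff _) h0 hvhit)
  obtain ⟨H', hH'τ, hH'⟩ := Set.not_subset.1 hc₂
  have hH'S : H' ∈ S := hH'τ.1
  have hHc : ∀ w ∈ H.verts, fire G D₀ (T c) w = 0 := by
    intro w hw
    by_contra hne
    exact hHτ (hmax _ (hTeff c) hc₁ ⟨hH, w, hw, lt_of_le_of_ne (hTeff c w) (Ne.symm hne)⟩)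
  have hH'c : ∀ w ∈ H'.verts, fire G D₀ (T (c - 1)) w = 0 := by
    intro w hw
    by_contra hne
    exact hH' ⟨hH'S, w, hw, lt_of_le_of_ne (hTeff (c - 1) w) (Ne.symm hne)⟩
  set U : Finset V := univ.filter fun u => c ≤ σ u with hU
  have hmemU : ∀ u, u ∈ U ↔ c ≤ σ u := fun u => by simp [hU]
  have hin : ∀ w ∈ U, (#(G.neighborFinset w \ U) : ℤ) ≤ fire G D₀ (T c) w := by
    intro w hw
    have h1 := hTeff (c - 1) w
    rw [hTfire, fire_max_pred, ← hTfire, if_pos ((hmemU w).1 hw), ← hU] at h1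
    linarith
  have hout : ∀ w ∉ U, fire G D₀ (T (c - 1)) w =
      fire G D₀ (T c) w + #(G.neighborFinset w ∩ U) := by
    intro w hw
    rw [hTfire, fire_max_pred, ← hTfire, if_neg (mt (hmemU w).2 hw), ← hU]
  -- By maximality `H` carries no chips at threshold c. An edge of `H` leaving U would need one at
  -- its end in U, to be sent across.
  have hHU : H.verts ⊆ (U : Set V)ᶜ := by
    intro x hx hxU
    have hvU : v ∉ (U : Set V) := fun h => by
      have := (hmemU v).1 (mem_coe.1 h)
      omega
    obtain ⟨a, b, hab, ha, hb⟩ := exists_adj_of_connected (hconn H hH) hx hv hxU hvU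
    have h1 := hin a ha
    rw [hHc a (H.edge_vert hab)] at h1
    have h2 : 0 < #(G.neighborFinset a \ U) :=
      card_pos.2 ⟨b, by simpa using ⟨H.adj_sub hab, hb⟩⟩
    omega
  -- `H'` loses its last chips in this firing, so it meets U. An edge of `H'` leaving U would
  -- deliver a chip to its outer end.
  have hH'U : H'.verts ⊆ (U : Set V) := by
    intro x hx
    by_contra hxU
    obtain ⟨-, y, hy, hpos⟩ := hc₁ hH'τ
    have hyU : y ∈ (U : Set V) := by
      by_contra hyU
      have h1 := hout y hyU
      rw [hH'c y hy] at h1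
      omega
    obtain ⟨a, b, hab, ha, hb⟩ := exists_adj_of_connected (hconn H' hH'S) hy hx hyU hxU
    have h1 := hout b hb
    rw [hH'c b (H'.edge_vert hab.symm)] at h1
    have h2 : 0 < #(G.neighborFinset b ∩ U) :=
      card_pos.2 ⟨a, by simpa using ⟨(H'.adj_sub hab).symm, ha⟩⟩
    have h3 := hTeff c b
    omega
  refine (min_le_right _ _).trans ((eggCutNumber_le hconn U ⟨H', hH'S, hH'U⟩
    ⟨H, hH, hHU⟩).trans (Nat.cast_le.2 ?_))
  rw [outdegree_eq_sum, ← Nat.cast_le (α := ℤ), Nat.cast_sum, ← hsum (T c)]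
  exact (sum_le_sum hin).trans (sum_le_univ_sum_of_nonneg (hTeff c))

/-- The scramble number is a lower bound for the gonality. -/
theorem sn_le_gon : sn G ≤ gon G := by
  obtain ⟨D, hD, h⟩ := exists_hasPositiveRank_gon G
  exact iSup₂_le fun S hS => scrambleOrder_le G hS hD h

end Fire

/-! ### Dissociation sets in triangle-free graphs: the upper bound on gonality -/

/-- There are no three mutually adjacent vertices. -/
def TriangleFree {V : Type*} (G : SimpleGraph V) : Prop :=
  ∀ a b c, G.Adj a b → G.Adj b c → ¬ G.Adj a c

lemma triangleFree_of_egirth {V : Type*} {G : SimpleGraph V} (h : 4 ≤ G.egirth) :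
    TriangleFree G := by
  classical
  intro a b c hab hbc hac
  obtain ⟨u, w, hw, h3⟩ := SimpleGraph.is3Clique_iff_exists_cycle_length_three.1
    ⟨{a, b, c}, SimpleGraph.is3Clique_triple_iff.2 ⟨hab, hac, hbc⟩⟩
  have := h.trans (SimpleGraph.egirth_le_length hw)
  rw [h3] at this
  exact absurd this (by decide)

section Dissociation

variable {V : Type*} [Fintype V] [DecidableEq V] (G : SimpleGraph V) [DecidableRel G.Adj]

lemma fire_indicator (D : V → ℤ) (B : Finset V) (w : V) :
    fire G D (fun u => if u ∈ B then -1 else 0) w = D w +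
      if w ∈ B then (#(G.neighborFinset w \ B) : ℤ) else -(#(G.neighborFinset w ∩ B) : ℤ) := by
  have h : fire G D (fun u => if u ∈ B then -1 else 0) w =
      D w + ∑ u, if G.Adj w u then (if u ∈ B then (-1 : ℤ) else 0) - (if w ∈ B then -1 else 0)
        else 0 := by
    simp only [fire]
  rw [h]
  congr 1
  split_ifs with hw
  · rw [card_eq_sum_ones, Nat.cast_sum]
    have : G.neighborFinset w \ B = univ.filter fun u => G.Adj w u ∧ u ∉ B := by
      ext u; simp
    rw [this, sum_filter]
    refine sum_congr rfl fun u _ => ?_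
    by_cases h1 : G.Adj w u <;> by_cases h2 : u ∈ B <;> simp [h1, h2]
  · rw [card_eq_sum_ones, Nat.cast_sum, ← sum_neg_distrib]
    have : G.neighborFinset w ∩ B = univ.filter fun u => G.Adj w u ∧ u ∈ B := by
      ext u; simp
    rw [this, sum_filter]
    refine sum_congr rfl fun u _ => ?_
    by_cases h1 : G.Adj w u <;> by_cases h2 : u ∈ B <;> simp [h1, h2]

/-- In a triangle-free graph of minimum degree at least two, one chip on each vertex outside a
dissociation set gives a divisor of positive rank. -/
lemma gon_le_of_isDissociation (hG : TriangleFree G) (hδ : ∀ v, 2 ≤ G.degree v) (U : Finset V)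
    (hU : IsDissociation G {v | v ∉ U}) : gon G ≤ #U := by
  set D : V → ℤ := fun w => if w ∈ U then 1 else 0 with hD
  refine gon_le G (D := D) (by simp [hD]) fun v => ?_
  by_cases hv : v ∈ U
  · refine ⟨0, fun w => ?_⟩
    have h1 : fire G (D - Pi.single v 1) 0 w = D w - (Pi.single v 1 : V → ℤ) w := by simp [fire]
    have h2 : 0 ≤ fire G (D - Pi.single v 1) 0 w := by
      rw [h1]
      by_cases hw : w = v
      · subst hw; simp [hD, hv]
      · simp only [Pi.single_eq_of_ne hw, hD]; split_ifs <;> simp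
    convert h2
  -- `B` is the component of v in the graph induced on the chipless vertices: v alone or an edge.
  -- All of `B` borrows once. Then v gains at least deg v - 1 ≥ 1, a vertex of `U` loses at most one
  -- chip because there are no triangles, and other chipless vertices have no neighbour in `B`.
  set B : Finset V := insert v (G.neighborFinset v \ U) with hB
  have hmemB : ∀ x, x ∈ B ↔ x = v ∨ G.Adj v x ∧ x ∉ U := fun x => by simp [hB]
  have hBU : ∀ x ∈ B, x ∉ U := by
    intro x hx
    rcases (hmemB x).1 hx with rfl | h
    exacts [hv, h.2]
  refine ⟨fun u => if u ∈ B then -1 else 0, fun w => ?_⟩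
  suffices h : 0 ≤ fire G (D - Pi.single v 1) (fun u => if u ∈ B then -1 else 0) w by convert h
  rw [fire_indicator]
  by_cases hwv : w = v
  · subst hwv
    have hwB : w ∈ B := (hmemB w).2 (Or.inl rfl)
    have h1 : #(G.neighborFinset w ∩ B) ≤ 1 := by
      refine card_le_one.2 fun a ha b hb => ?_
      rw [mem_inter, SimpleGraph.mem_neighborFinset] at ha hb
      exact hU w hv a (hBU a ha.2) b (hBU b hb.2) ha.1 hb.1
    have h2 := hδ w
    rw [← SimpleGraph.card_neighborFinset_eq_degree,
      ← card_sdiff_add_card_inter (G.neighborFinset w) B] at h2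
    simp only [if_pos hwB, Pi.sub_apply, Pi.single_eq_same, hD, if_neg hv]
    omega
  · rw [Pi.sub_apply, Pi.single_eq_of_ne hwv, sub_zero]
    by_cases hwB : w ∈ B
    · simp only [if_pos hwB, hD, if_neg (hBU w hwB)]
      omega
    rw [if_neg hwB]
    by_cases hwU : w ∈ U
    · have h1 : #(G.neighborFinset w ∩ B) ≤ 1 := by
        refine card_le_one.2 fun a ha b hb => ?_
        rw [mem_inter, SimpleGraph.mem_neighborFinset, hmemB] at ha hb
        rcases ha with ⟨hwa, rfl | ha⟩ <;> rcases hb with ⟨hwb, rfl | hb⟩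
        · rfl
        · exact absurd hwb (hG _ _ _ hwa hb.1)
        · exact absurd hwa (hG _ _ _ hwb ha.1)
        · exact hU v hv a ha.2 b hb.2 ha.1 hb.1
      simp only [hD, if_pos hwU]
      omega
    · have h1 : G.neighborFinset w ∩ B = ∅ := by
        refine eq_empty_of_forall_notMem fun x hx => ?_
        rw [mem_inter, SimpleGraph.mem_neighborFinset, hmemB] at hx
        rcases hx with ⟨hwx, rfl | hx⟩
        · exact hwB ((hmemB w).2 (Or.inr ⟨hwx.symm, hwU⟩))
        · exact hwv (hU x hx.2 w hwU v hv hwx.symm hx.1.symm)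
      simp [h1, hD, hwU]

end Dissociation

/-! ### Scrambles of two-edge paths -/

section PathEggs

variable {V : Type*}

/-- The connected subgraphs whose vertices are those of a two-edge path. -/
def pathEggs (G : SimpleGraph V) : Set G.Subgraph :=
  {H | H.Connected ∧ ∃ u v w, G.Adj v u ∧ G.Adj v w ∧ u ≠ w ∧ H.verts = {u, v, w}}

lemma exists_connected_path {G : SimpleGraph V} {u v w : V} (hu : G.Adj v u) (hw : G.Adj v w) :
    ∃ H : G.Subgraph, H.Connected ∧ H.verts = {u, v, w} := by
  refine ⟨G.subgraphOfAdj hu ⊔ G.subgraphOfAdj hw,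
    SimpleGraph.Subgraph.connected_sup
      (SimpleGraph.Subgraph.subgraphOfAdj_connected hu).preconnected
      (SimpleGraph.Subgraph.subgraphOfAdj_connected hw).preconnected ⟨v, by simp⟩, ?_⟩
  ext x
  simp
  tauto

lemma ncard_path {G : SimpleGraph V} {u v w : V} (hu : G.Adj v u) (hw : G.Adj v w) (huw : u ≠ w) :
    ({u, v, w} : Set V).ncard = 3 := by
  rw [Set.ncard_eq_three]
  exact ⟨u, v, w, hu.ne', huw, hw.ne, rfl⟩

/-- Disjoint eggs need distinct hitting vertices. -/
lemma card_le_hittingNumber [DecidableEq V] {G : SimpleGraph V} {S : Set G.Subgraph}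
    {P : Finset (Finset V)} (hP : (P : Set (Finset V)).PairwiseDisjoint id)
    (hS : ∀ p ∈ P, ∃ H ∈ S, H.verts = p) : (#P : ℕ∞) ≤ hittingNumber G S := by
  refine le_iInf₂ fun T hT => Nat.cast_le.2 ?_
  have : ∀ p ∈ P, ∃ v ∈ T, v ∈ p := by
    intro p hp
    obtain ⟨H, hH, hHp⟩ := hS p hp
    obtain ⟨v, hv, hvH⟩ := hT H hH
    exact ⟨v, hv, by rw [hHp] at hvH; exact hvH⟩
  rcases isEmpty_or_nonempty V with hV | hV
  · have : P = ∅ := eq_empty_of_forall_notMem fun p hp => hV.elim (this p hp).choose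
    simp [this]
  choose! f hfT hfp using this
  refine card_le_card_of_injOn f hfT fun p hp q hq hpq => ?_
  by_contra hne
  exact disjoint_left.1 (hP hp hq hne) (hfp p hp) (hpq ▸ hfp q hq)

lemma IsPathPacking.card_biUnion [DecidableEq V] {G : SimpleGraph V} {P : Finset (Finset V)}
    (hP : IsPathPacking G P) : #(P.biUnion id) = 3 * #P := by
  rw [Finset.card_biUnion hP.disjoint, sum_const_nat (m := 3), mul_comm]
  intro p hp
  obtain ⟨u, v, w, hu, hw, huw, rfl⟩ := hP.path p hp
  exact card_eq_three.2 ⟨u, v, w, hu.ne', huw, hw.ne, rfl⟩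

lemma IsPathPacking.three_mul_card_le [Fintype V] [DecidableEq V] {G : SimpleGraph V}
    {P : Finset (Finset V)} (hP : IsPathPacking G P) : 3 * #P ≤ Fintype.card V :=
  hP.card_biUnion ▸ card_le_univ _

/-- If every cut that separates two two-edge paths has at least `#P` edges, then the packing `P`
gives a lower bound for the scramble number. -/
lemma IsPathPacking.card_le_sn [Fintype V] [DecidableEq V] {G : SimpleGraph V}
    {P : Finset (Finset V)} (hP : IsPathPacking G P) (hne : P.Nonempty)
    (hcut : ∀ A : Finset V, (∃ u v w, G.Adj v u ∧ G.Adj v w ∧ u ≠ w ∧ u ∈ A ∧ v ∈ A ∧ w ∈ A) →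
      (∃ u v w, G.Adj v u ∧ G.Adj v w ∧ u ≠ w ∧ u ∉ A ∧ v ∉ A ∧ w ∉ A) → #P ≤ outdegree G A) :
    (#P : ℕ∞) ≤ sn G := by
  have hegg : ∀ p ∈ P, ∃ H ∈ pathEggs G, H.verts = p := by
    intro p hp
    obtain ⟨u, v, w, hu, hw, huw, rfl⟩ := hP.path p hp
    obtain ⟨H, hH, hHv⟩ := exists_connected_path hu hw
    exact ⟨H, ⟨hH, u, v, w, hu, hw, huw, hHv⟩, by simp [hHv]⟩
  obtain ⟨p, hp⟩ := hne
  obtain ⟨H, hH, -⟩ := hegg p hp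
  refine le_trans (le_min (card_le_hittingNumber hP.disjoint hegg) (le_eggCutNumber ?_))
    (le_iSup₂_of_le (pathEggs G) ⟨⟨H, hH⟩, fun K hK => hK.1⟩ le_rfl)
  rintro A ⟨H₁, ⟨-, u₁, v₁, w₁, hu₁, hw₁, hne₁, hv₁⟩, hA₁⟩
    ⟨H₂, ⟨-, u₂, v₂, w₂, hu₂, hw₂, hne₂, hv₂⟩, hA₂⟩
  rw [hv₁] at hA₁
  rw [hv₂] at hA₂
  exact hcut A ⟨u₁, v₁, w₁, hu₁, hw₁, hne₁, hA₁ (by simp), hA₁ (by simp), hA₁ (by simp)⟩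
    ⟨u₂, v₂, w₂, hu₂, hw₂, hne₂, hA₂ (by simp), hA₂ (by simp), hA₂ (by simp)⟩

lemma outdegree_compl [Fintype V] [DecidableEq V] (G : SimpleGraph V) (A : Finset V) :
    outdegree G (Aᶜ : Finset V) = outdegree G A := by
  refine Set.ncard_congr (fun p _ => p.swap) ?_ ?_ ?_
  · rintro ⟨x, y⟩ ⟨hx, hy, hxy⟩
    simp only [coe_compl, Set.mem_compl_iff, not_not] at hx hy
    exact ⟨hy, hx, hxy.symm⟩
  · intro p q _ _ h
    exact Prod.swap_injective h
  · rintro ⟨x, y⟩ ⟨hx, hy, hxy⟩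
    exact ⟨(y, x), ⟨by simpa using hy, by simpa using hx, hxy.symm⟩, rfl⟩

end PathEggs

/-! ### Cuts in triangle-free graphs -/

section TriangleFreeCuts

variable {V : Type*} [Fintype V] [DecidableEq V] {G : SimpleGraph V} [DecidableRel G.Adj]

/-- Adjacent vertices have disjoint neighbourhoods. -/
lemma TriangleFree.card_inter_add_card_inter_le (hG : TriangleFree G) (A : Finset V) {x y : V}
    (h : G.Adj x y) : #(G.neighborFinset x ∩ A) + #(G.neighborFinset y ∩ A) ≤ #A := by
  rw [← card_union_of_disjoint]
  · exact card_le_card (union_subset inter_subset_right inter_subset_right)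
  · rw [disjoint_left]
    intro z hx hy
    rw [mem_inter, SimpleGraph.mem_neighborFinset] at hx hy
    exact hG x y z h hy.1 hx.1

lemma TriangleFree.degree_add_degree_le (hG : TriangleFree G) {x y : V} (h : G.Adj x y) :
    G.degree x + G.degree y ≤ Fintype.card V := by
  simpa using hG.card_inter_add_card_inter_le univ h

/-- Mantel's theorem. -/
lemma TriangleFree.two_mul_sum_card_inter_le (hG : TriangleFree G) (A : Finset V) :
    2 * ∑ x ∈ A, #(G.neighborFinset x ∩ A) ≤ #A * #A := by
  rcases A.eq_empty_or_nonempty with rfl | hA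
  · simp
  obtain ⟨v, hv, hmax⟩ := A.exists_max_image (fun x => #(G.neighborFinset x ∩ A)) hA
  set D := #(G.neighborFinset v ∩ A) with hD
  have hDA : D ≤ #A := card_le_card inter_subset_right
  -- The D neighbours of v in A have inner degree at most |A| - D, the other |A| - D vertices at
  -- most D. The total is at most 2D(|A| - D) ≤ |A|²/2.
  have h1 : ∑ x ∈ A ∩ G.neighborFinset v, #(G.neighborFinset x ∩ A) ≤ D * (#A - D) := by
    have : #(A ∩ G.neighborFinset v) = D := by rw [inter_comm]
    rw [← this, ← smul_eq_mul]
    refine sum_le_card_nsmul _ _ _ fun x hx => ?_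
    rw [mem_inter, SimpleGraph.mem_neighborFinset] at hx
    have := hG.card_inter_add_card_inter_le A hx.2
    omega
  have h2 : ∑ x ∈ A \ G.neighborFinset v, #(G.neighborFinset x ∩ A) ≤ (#A - D) * D := by
    have : #(A \ G.neighborFinset v) = #A - D := by
      rw [card_sdiff, hD]
    rw [← this, ← smul_eq_mul]
    exact sum_le_card_nsmul _ _ _ fun x hx => hmax x (mem_sdiff.1 hx).1
  have h3 := sum_inter_add_sum_sdiff A (G.neighborFinset v) fun x => #(G.neighborFinset x ∩ A)
  obtain ⟨e, he⟩ := Nat.exists_eq_add_of_le hDA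
  rw [he, Nat.add_sub_cancel_left] at h1 h2
  rw [he]
  rw [← h3]
  rcases le_total D e with h | h
  · obtain ⟨f, rfl⟩ := Nat.exists_eq_add_of_le h
    nlinarith
  · obtain ⟨f, hf⟩ := Nat.exists_eq_add_of_le h
    rw [hf] at h1 h2 ⊢
    nlinarith

lemma card_inter_add_card_sdiff (A : Finset V) (x : V) :
    #(G.neighborFinset x ∩ A) + #(G.neighborFinset x \ A) = G.degree x := by
  rw [add_comm, card_sdiff_add_card_inter, SimpleGraph.card_neighborFinset_eq_degree]

/-- Cuts in dense triangle-free graphs are large. -/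
lemma TriangleFree.card_le_two_mul_outdegree (hG : TriangleFree G)
    (hδ : ∀ v, Fintype.card V + 4 ≤ 4 * G.degree v) (A : Finset V) (h3 : 3 ≤ #A)
    (hA : 2 * #A ≤ Fintype.card V) : Fintype.card V ≤ 2 * outdegree G A := by
  have h1 := hG.two_mul_sum_card_inter_le A
  have h2 : #A * (Fintype.card V + 4) ≤ 4 * ∑ x ∈ A, G.degree x := by
    rw [mul_sum, ← smul_eq_mul]
    exact card_nsmul_le_sum _ _ _ fun x _ => hδ x
  have h4 : ∑ x ∈ A, G.degree x = ∑ x ∈ A, #(G.neighborFinset x ∩ A) + outdegree G A := by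
    rw [outdegree_eq_sum, ← sum_add_distrib]
    exact sum_congr rfl fun x _ => (card_inter_add_card_sdiff A x).symm
  -- With a = |A| and n = 2a + t, the degree bound and Mantel's theorem give 4·cut ≥ a(t + 4) ≥ 4a +
  -- 2t = 2n.
  obtain ⟨t, ht⟩ := Nat.exists_eq_add_of_le hA
  rw [h4, ht] at h2
  rw [ht]
  nlinarith

variable (G) in
/-- The number of edges that lead from `x` to the other side of the cut `A`. -/
def crossDegree (A : Finset V) (x : V) : ℕ :=
  if x ∈ A then #(G.neighborFinset x \ A) else #(G.neighborFinset x ∩ A)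

variable (G) in
/-- The number of neighbours of `x` on its own side of the cut `A`. -/
def sideDegree (A : Finset V) (x : V) : ℕ :=
  if x ∈ A then #(G.neighborFinset x ∩ A) else #(G.neighborFinset x \ A)

lemma crossDegree_add_sideDegree (A : Finset V) (x : V) :
    crossDegree G A x + sideDegree G A x = G.degree x := by
  have := card_inter_add_card_sdiff (G := G) A x
  rw [crossDegree, sideDegree]
  split_ifs <;> omega

lemma neighborFinset_inter_compl (A : Finset V) (x : V) :
    G.neighborFinset x ∩ Aᶜ = G.neighborFinset x \ A := by
  rw [sdiff_eq_inter_compl]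

lemma TriangleFree.sideDegree_add_le (hG : TriangleFree G) {A : Finset V} {x y : V}
    (h : G.Adj x y) (hx : x ∈ A) (hy : y ∈ A) : sideDegree G A x + sideDegree G A y ≤ #A := by
  rw [sideDegree, sideDegree, if_pos hx, if_pos hy]
  exact hG.card_inter_add_card_inter_le A h

lemma TriangleFree.sideDegree_add_le_compl (hG : TriangleFree G) {A : Finset V} {x y : V}
    (h : G.Adj x y) (hx : x ∉ A) (hy : y ∉ A) : sideDegree G A x + sideDegree G A y ≤ #Aᶜ := by
  rw [sideDegree, sideDegree, if_neg hx, if_neg hy, ← neighborFinset_inter_compl,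
    ← neighborFinset_inter_compl]
  exact hG.card_inter_add_card_inter_le Aᶜ h

lemma sideDegree_le {A : Finset V} {x : V} (hx : x ∈ A) : sideDegree G A x ≤ #A := by
  rw [sideDegree, if_pos hx]
  exact card_le_card inter_subset_right

lemma sideDegree_le_compl {A : Finset V} {x : V} (hx : x ∉ A) : sideDegree G A x ≤ #Aᶜ := by
  rw [sideDegree, if_neg hx, ← neighborFinset_inter_compl]
  exact card_le_card inter_subset_right

lemma card_le_crossDegree {A : Finset V} {x : V} {T : Finset V}
    (hT : ∀ y ∈ T, G.Adj x y ∧ ¬ (x ∈ A ↔ y ∈ A)) : #T ≤ crossDegree G A x := by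
  rw [crossDegree]
  split_ifs with hx
  · refine card_le_card fun y hy => ?_
    have := hT y hy
    simpa [hx] using this
  · refine card_le_card fun y hy => ?_
    have := hT y hy
    simpa [hx] using this

lemma one_le_crossDegree {A : Finset V} {x y : V} (hxy : G.Adj x y) (h : ¬ (x ∈ A ↔ y ∈ A)) :
    1 ≤ crossDegree G A x := by
  rw [← card_singleton y]
  refine card_le_crossDegree fun z hz => ?_
  rw [mem_singleton] at hz
  subst hz
  exact ⟨hxy, h⟩

lemma sum_crossDegree (A : Finset V) : ∑ x ∈ A, crossDegree G A x = outdegree G A := by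
  rw [outdegree_eq_sum]
  exact sum_congr rfl fun x hx => if_pos hx

lemma sum_crossDegree_compl (A : Finset V) : ∑ x ∈ Aᶜ, crossDegree G A x = outdegree G A := by
  rw [← outdegree_compl, outdegree_eq_sum]
  refine sum_congr rfl fun x hx => ?_
  rw [crossDegree, if_neg (mem_compl.1 hx)]
  congr 1
  ext y; simp

/-- In the smaller side of a cut, two-edge paths of large degree sum meet many edges of the cut. -/
lemma TriangleFree.le_crossDegree_of_mem (hG : TriangleFree G) {m : ℕ} {A : Finset V} {u v w : V}
    (hu : G.Adj v u) (hw : G.Adj v w) (huA : u ∈ A) (hvA : v ∈ A) (hwA : w ∈ A)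
    (hsum : m ≤ G.degree u + G.degree v + G.degree w) :
    m + sideDegree G A v ≤
      crossDegree G A u + crossDegree G A v + crossDegree G A w + 2 * #A := by
  have h2 := hG.sideDegree_add_le hu hvA huA
  have h3 := hG.sideDegree_add_le hw hvA hwA
  have h4 := crossDegree_add_sideDegree (G := G) A u
  have h5 := crossDegree_add_sideDegree (G := G) A v
  have h6 := crossDegree_add_sideDegree (G := G) A w
  omega

/-- The side degrees of the adjacent v, w sum to at most the size of their side, and that of u is at
most the size of the other. So at most n of the total degree n + 5 stays within sides. -/
lemma TriangleFree.four_le_crossDegree_of_mixed (hG : TriangleFree G) {A : Finset V} {u v w : V}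
    (hw : G.Adj v w) (huv : ¬ (u ∈ A ↔ v ∈ A)) (hvw : v ∈ A ↔ w ∈ A)
    (hsum : Fintype.card V + 5 ≤ G.degree u + G.degree v + G.degree w) :
    4 ≤ crossDegree G A u + crossDegree G A v + crossDegree G A w := by
  have hcompl : #A + #Aᶜ = Fintype.card V := card_add_card_compl A
  have h1 := crossDegree_add_sideDegree (G := G) A u
  have h2 := crossDegree_add_sideDegree (G := G) A v
  have h3 := crossDegree_add_sideDegree (G := G) A w
  by_cases hv : v ∈ A
  · have hu : u ∉ A := fun h => huv ⟨fun _ => hv, fun _ => h⟩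
    have h4 := hG.sideDegree_add_le hw hv (hvw.1 hv)
    have h5 := sideDegree_le_compl (G := G) hu
    omega
  · have hu : u ∈ A := by
      by_contra h
      exact huv ⟨fun h' => absurd h' h, fun h' => absurd h' hv⟩
    have h4 := hG.sideDegree_add_le_compl hw hv fun h => hv (hvw.2 h)
    have h5 := sideDegree_le (G := G) hu
    omega

/-- A two-edge path of large degree sum meets a cut at least four times, unless one of its ends has
large degree in the larger side. -/
lemma TriangleFree.four_le_crossDegree (hG : TriangleFree G) {A : Finset V}
    (hA : 2 * #A ≤ Fintype.card V) {u v w : V} (hu : G.Adj v u) (hw : G.Adj v w) (huw : u ≠ w)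
    (hsum : Fintype.card V + 5 ≤ G.degree u + G.degree v + G.degree w)
    (hu' : u ∉ A → sideDegree G A u ≤ #A + 1) (hw' : w ∉ A → sideDegree G A w ≤ #A + 1) :
    4 ≤ crossDegree G A u + crossDegree G A v + crossDegree G A w := by
  have hcompl : #A + #Aᶜ = Fintype.card V := card_add_card_compl A
  by_cases huv : u ∈ A ↔ v ∈ A
  · by_cases hvw : v ∈ A ↔ w ∈ A
    · by_cases hv : v ∈ A
      · have := hG.le_crossDegree_of_mem hu hw (huv.2 hv) hv (hvw.1 hv) hsum
        omega
      · have huA : u ∉ A := fun h => hv (huv.1 h)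
        have hwA : w ∉ A := fun h => hv (hvw.2 h)
        have h1 := hu' huA
        have h2 := hw' hwA
        have h3 := hG.sideDegree_add_le_compl hu hv huA
        have h4 := hG.sideDegree_add_le_compl hw hv hwA
        have h5 := crossDegree_add_sideDegree (G := G) A u
        have h6 := crossDegree_add_sideDegree (G := G) A v
        have h7 := crossDegree_add_sideDegree (G := G) A w
        -- Here the path lies in the larger side. Its side degrees sum to at most (|A| + 1) + (n -
        -- |A|) = n + 1, leaving four crossings; this fixes the threshold |A| + 1.
        omega
    · have := hG.four_le_crossDegree_of_mixed (u := w) hu (fun h => hvw h.symm) huv.symm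
        (by omega)
      omega
  · by_cases hvw : v ∈ A ↔ w ∈ A
    · exact hG.four_le_crossDegree_of_mixed hw huv hvw hsum
    · have h1 := one_le_crossDegree hu.symm huv
      have h2 := one_le_crossDegree hw.symm fun h => hvw h.symm
      have h3 : #{u, w} ≤ crossDegree G A v := card_le_crossDegree fun y hy => by
        rcases mem_insert.1 hy with rfl | hy
        · exact ⟨hu, fun h => huv h.symm⟩
        · rw [mem_singleton] at hy
          subst hy
          exact ⟨hw, hvw⟩
      rw [card_pair huw] at h3
      omega

/-- The number of vertices of large degree in the larger side of a cut. -/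
lemma TriangleFree.card_filter_sideDegree_le (hG : TriangleFree G) {A : Finset V}
    (hA : 2 * #A ≤ Fintype.card V) (hA' : Fintype.card V < 3 * #A + 4) :
    #(Aᶜ.filter fun x => #A + 2 ≤ sideDegree G A x) + 2 * #A ≤ Fintype.card V := by
  set H : Finset V := Aᶜ.filter fun x => #A + 2 ≤ sideDegree G A x with hH
  have hcompl : #A + #Aᶜ = Fintype.card V := card_add_card_compl A
  have hmemH : ∀ y, y ∈ H ↔ y ∉ A ∧ #A + 2 ≤ sideDegree G A y := fun y => by simp [hH]
  -- Adjacent members would give 2(|A| + 2) ≤ n - |A|, against `hA'`. Hence the |A| + 2 or more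
  -- neighbours that a member has on its side all avoid `H`, which bounds |H|.
  have hHindep : ∀ y ∈ H, ∀ z ∈ H, ¬ G.Adj y z := by
    intro y hy z hz hyz
    rw [hmemH] at hy hz
    have := hG.sideDegree_add_le_compl hyz hy.1 hz.1
    omega
  rcases H.eq_empty_or_nonempty with h | ⟨y, hy⟩
  · rw [h, card_empty]; omega
  · have hy' := (hmemH y).1 hy
    have h1 : sideDegree G A y + #H ≤ #Aᶜ := by
      rw [sideDegree, if_neg hy'.1, ← neighborFinset_inter_compl, ← card_union_of_disjoint]
      · exact card_le_card (union_subset inter_subset_right (filter_subset _ _))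
      · rw [disjoint_left]
        intro z hz hzH
        rw [mem_inter, SimpleGraph.mem_neighborFinset] at hz
        exact hHindep y hy z hzH hz.1
    omega

/-- If all degrees in a triangle-free graph are at least two and the two-edge paths have large
degree sums, then all degrees are at least five. -/
lemma TriangleFree.five_le_degree (hG : TriangleFree G) (hδ : ∀ v, 2 ≤ G.degree v)
    (hpath : ∀ u v w, G.Adj v u → G.Adj v w → u ≠ w →
      Fintype.card V + 5 ≤ G.degree u + G.degree v + G.degree w) (w : V) : 5 ≤ G.degree w := by
  obtain ⟨v, hv⟩ := card_pos.1 (lt_of_lt_of_le two_pos (hδ w))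
  rw [SimpleGraph.mem_neighborFinset] at hv
  obtain ⟨u, hu, huw⟩ := exists_mem_ne (lt_of_lt_of_le one_lt_two (hδ v)) w
  rw [SimpleGraph.mem_neighborFinset] at hu
  have h1 := hpath u v w hu hv.symm huw
  have h2 := hG.degree_add_degree_le hu
  omega

/-- The edges of a cut that are met by the neighbours of a vertex that is not on the cut. -/
lemma TriangleFree.le_outdegree_of_crossDegree_eq_zero (hG : TriangleFree G)
    (hδ : ∀ v, 5 ≤ G.degree v)
    (hpath : ∀ u v w, G.Adj v u → G.Adj v w → u ≠ w →
      Fintype.card V + 5 ≤ G.degree u + G.degree v + G.degree w) {A : Finset V} {x : V}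
    (hxA : x ∈ A) (hx : crossDegree G A x = 0) :
    2 * Fintype.card V + 20 ≤ outdegree G A + 4 * #A := by
  have hxN : ∀ y, G.Adj x y → y ∈ A := by
    intro y hxy
    by_contra hy
    have := one_le_crossDegree (A := A) hxy fun h => hy (h.1 hxA)
    omega
  have hdx : 5 ≤ sideDegree G A x := by
    have h1 := crossDegree_add_sideDegree (G := G) A x
    have h2 := hδ x
    omega
  -- All edges at x stay in A, so the path y, x, z gains at least five from the side degree of x.
  -- Two disjoint pairs of neighbours then double the bound.
  have hpair : ∀ y z, G.Adj x y → G.Adj x z → y ≠ z →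
      Fintype.card V + 10 ≤ crossDegree G A y + crossDegree G A z + 2 * #A := by
    intro y z hy hz hyz
    have := hG.le_crossDegree_of_mem hy hz (hxN y hy) hxA (hxN z hz) (hpath y x z hy hz hyz)
    omega
  have hcardN : 5 ≤ #(G.neighborFinset x) := hδ x
  obtain ⟨y₁, hy₁, y₂, hy₂, h12⟩ := one_lt_card.1 (show 1 < #(G.neighborFinset x) by omega)
  have hcardN' : 1 < #(G.neighborFinset x \ {y₁, y₂}) := by
    have := le_card_sdiff {y₁, y₂} (G.neighborFinset x)
    rw [card_pair h12] at this
    omega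
  obtain ⟨y₃, hy₃, y₄, hy₄, h34⟩ := one_lt_card.1 hcardN'
  simp only [mem_sdiff, SimpleGraph.mem_neighborFinset, mem_insert, mem_singleton, not_or]
    at hy₁ hy₂ hy₃ hy₄
  have h1 := hpair y₁ y₂ hy₁ hy₂ h12
  have h2 := hpair y₃ y₄ hy₃.1 hy₄.1 h34
  have hsub : ({y₁, y₂, y₃, y₄} : Finset V) ⊆ A := by
    intro z hz
    simp only [mem_insert, mem_singleton] at hz
    rcases hz with rfl | rfl | rfl | rfl
    exacts [hxN _ hy₁, hxN _ hy₂, hxN _ hy₃.1, hxN _ hy₄.1]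
  have h3 := (sum_le_sum_of_subset hsub).trans_eq (sum_crossDegree (G := G) A)
  rw [sum_insert (by simp [h12, Ne.symm hy₃.2.1, Ne.symm hy₄.2.1]),
    sum_insert (by simp [Ne.symm hy₃.2.2, Ne.symm hy₄.2.2]), sum_insert (by simp [h34]),
    sum_singleton] at h3
  omega

/-- In a triangle-free graph in which the two-edge paths have large degree sums, a cut with a
two-edge path in its smaller side has at least as many edges as there are sets in a packing of
two-edge paths. -/
lemma TriangleFree.card_le_outdegree_of_path (hG : TriangleFree G) (hδ : ∀ v, 2 ≤ G.degree v)
    (hpath : ∀ u v w, G.Adj v u → G.Adj v w → u ≠ w →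
      Fintype.card V + 5 ≤ G.degree u + G.degree v + G.degree w)
    {P : Finset (Finset V)} (hP : IsPathPacking G P) (A : Finset V)
    (hA : 2 * #A ≤ Fintype.card V) {u₀ v₀ w₀ : V} (hu₀ : G.Adj v₀ u₀) (hw₀ : G.Adj v₀ w₀)
    (hne₀ : u₀ ≠ w₀) (huA : u₀ ∈ A) (hvA : v₀ ∈ A) (hwA : w₀ ∈ A) : #P ≤ outdegree G A := by
  by_contra hlt
  have hPn := hP.three_mul_card_le
  have hbound : Fintype.card V + 5 ≤ outdegree G A + 2 * #A := by
    have h1 := hG.le_crossDegree_of_mem hu₀ hw₀ huA hvA hwA (hpath u₀ v₀ w₀ hu₀ hw₀ hne₀)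
    have hsub : ({u₀, v₀, w₀} : Finset V) ⊆ A := by
      intro x hx
      simp only [mem_insert, mem_singleton] at hx
      rcases hx with rfl | rfl | rfl <;> assumption
    have h2 := (sum_le_sum_of_subset hsub).trans_eq (sum_crossDegree (G := G) A)
    rw [sum_insert (by simp [hu₀.ne', hne₀]), sum_insert (by simp [hw₀.ne]), sum_singleton] at h2
    omega
  -- Otherwise |A| is at most the cut C, and `hbound` gives n + 5 ≤ 3C < 3|P| ≤ n.
  obtain ⟨x, hxA, hx0⟩ : ∃ x ∈ A, crossDegree G A x = 0 := by
    by_contra hcon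
    push Not at hcon
    have : #A ≤ outdegree G A := by
      rw [← sum_crossDegree, card_eq_sum_ones]
      exact sum_le_sum fun x hx => Nat.one_le_iff_ne_zero.2 (hcon x hx)
    omega
  have hstrong := hG.le_outdegree_of_crossDegree_eq_zero (hG.five_le_degree hδ hpath) hpath hxA hx0
  have hHcard := hG.card_filter_sideDegree_le hA (by omega)
  set H : Finset V := Aᶜ.filter fun x => #A + 2 ≤ sideDegree G A x with hH
  -- The charge: each cut edge pays one at both ends, and a vertex of `H` pays for a whole path.
  -- Every path of P collects at least four, so 4|P| ≤ 2C + 4|H|. Now |H| ≤ n - 2|A| and `hstrong`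
  -- give 4|H| ≤ 2C - 40, contradicting C < |P|.
  set g : V → ℕ := fun x => crossDegree G A x + if x ∈ H then 4 else 0 with hg
  have hgsum : ∑ x, g x = 2 * outdegree G A + 4 * #H := by
    rw [hg, sum_add_distrib, ← sum_add_sum_compl A, sum_crossDegree, sum_crossDegree_compl,
      ← sum_filter, sum_const, filter_mem_eq_inter, univ_inter, smul_eq_mul]
    ring
  have hcg : ∀ y, crossDegree G A y ≤ g y := fun y => Nat.le_add_right _ _
  have hgH : ∀ y, g y < 4 → y ∉ A → sideDegree G A y ≤ #A + 1 := by
    intro y hgy hy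
    by_contra hdy
    have : y ∈ H := mem_filter.2 ⟨mem_compl.2 hy, by omega⟩
    simp only [hg, this, if_true] at hgy
    omega
  have hfour : ∀ p ∈ P, 4 ≤ ∑ x ∈ p, g x := by
    intro p hp
    obtain ⟨u, v, w, hu, hw, huw, rfl⟩ := hP.path p hp
    rw [sum_insert (by simp [hu.ne', huw]), sum_insert (by simp [hw.ne]), sum_singleton]
    by_contra hlt4
    have h1 := hG.four_le_crossDegree hA hu hw huw (hpath u v w hu hw huw) (hgH u (by omega))
      (hgH w (by omega))
    have hgu := hcg u
    have hgv := hcg v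
    have hgw := hcg w
    omega
  have hfinal : 4 * #P ≤ 2 * outdegree G A + 4 * #H := by
    rw [← hgsum, mul_comm, ← smul_eq_mul]
    refine (card_nsmul_le_sum P _ 4 hfour).trans ?_
    have := sum_biUnion (f := g) hP.disjoint
    simp only [id] at this
    rw [← this]
    exact sum_le_univ_sum_of_nonneg fun _ => Nat.zero_le _
  omega

/-- The two edges of the path use up at least four of its degree sum; the rest bounds its outdegree.
-/
lemma degree_sum_of_le_xi {m : ℕ} (hxi : (m : ℕ∞) ≤ xi G 3) {u v w : V} (hu : G.Adj v u)
    (hw : G.Adj v w) (huw : u ≠ w) : m + 4 ≤ G.degree u + G.degree v + G.degree w := by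
  obtain ⟨H, hH, hHv⟩ := exists_connected_path hu hw
  have h1 : (m : ℕ∞) ≤ outdegree G ({u, v, w} : Set V) := by
    rw [← hHv]
    exact hxi.trans (iInf₂_le H ⟨hH, by rw [hHv, ncard_path hu hw huw]⟩)
  have h2 : m ≤ outdegree G (({u, v, w} : Finset V) : Set V) := by
    push_cast
    exact Nat.cast_le.1 h1
  rw [outdegree_eq_sum, sum_insert (by simp [hu.ne', huw]), sum_insert (by simp [hw.ne]),
    sum_singleton] at h2
  have h3 := card_inter_add_card_sdiff (G := G) {u, v, w} u
  have h4 := card_inter_add_card_sdiff (G := G) {u, v, w} v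
  have h5 := card_inter_add_card_sdiff (G := G) {u, v, w} w
  have h6 : 1 ≤ #(G.neighborFinset u ∩ {u, v, w}) := card_pos.2 ⟨v, by simp [hu.symm]⟩
  have h7 : 1 ≤ #(G.neighborFinset w ∩ {u, v, w}) := card_pos.2 ⟨v, by simp [hw.symm]⟩
  have h8 : 2 ≤ #(G.neighborFinset v ∩ {u, v, w}) := by
    rw [← card_pair huw]
    refine card_le_card fun a ha => ?_
    rcases mem_insert.1 ha with rfl | ha
    · simp [hu]
    · rw [mem_singleton] at ha
      subst ha
      simp [hw]
  omega

end TriangleFreeCuts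

lemma approximates_of_le {V : Type*} [Fintype V] {G : SimpleGraph V} {ρ a b : ℕ}
    (ha : gon G ≤ a) (hb : (b : ℕ∞) ≤ sn G) (hab : a ≤ ρ * b) : Approximates ρ G (a, b) := by
  have ha' : (gon G : ℕ∞) ≤ a := Nat.cast_le.2 ha
  have hab' : (a : ℕ∞) ≤ ρ * b := by exact_mod_cast hab
  have hsn := sn_le_gon G
  exact ⟨⟨ha', hab'.trans (mul_le_mul' le_rfl (hb.trans hsn))⟩, hsn.trans (ha'.trans hab'), hb⟩

/-- A scramble with a single egg has no egg-cut. This serves the one-vertex graph, which has no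
edges to use as eggs. -/
lemma one_le_sn {V : Type*} [Fintype V] {G : SimpleGraph V} (v : V) : 1 ≤ sn G := by
  have hS : IsScramble G {G.singletonSubgraph v} :=
    ⟨Set.singleton_nonempty _, by
      rintro H rfl
      exact SimpleGraph.Subgraph.singletonSubgraph_connected⟩
  refine le_trans (le_min ?_ ?_) (le_iSup₂_of_le _ hS le_rfl)
  · refine le_iInf₂ fun T hT => ?_
    obtain ⟨w, hw, -⟩ := hT _ rfl
    exact Nat.one_le_cast.2 (card_pos.2 ⟨w, hw⟩)
  · refine le_eggCutNumber (m := 1) ?_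
    rintro A ⟨H, rfl, h₁⟩ ⟨H', rfl, h₂⟩
    have hv : v ∈ (G.singletonSubgraph v).verts := by simp
    exact absurd (h₁ hv) (h₂ hv)

/-! ### Ones against zeros in the adjacency matrix -/

section Balance

variable {V : Type*} [Fintype V] {G : SimpleGraph V} [DecidableRel G.Adj]

lemma sum_adj_sign (v : V) :
    ∑ w, (if G.Adj v w then (1 : ℤ) else -1) = 2 * G.degree v - Fintype.card V := by
  have h : ∀ w, (if G.Adj v w then (1 : ℤ) else -1) = 2 * (if G.Adj v w then 1 else 0) - 1 := by
    intro w
    split_ifs <;> norm_num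
  simp only [h, sum_sub_distrib, ← mul_sum, sum_boole, sum_const, card_univ, nsmul_eq_mul, mul_one]
  rw [← SimpleGraph.card_neighborFinset_eq_degree, SimpleGraph.neighborFinset_eq_filter]

variable [DecidableEq V]

lemma TriangleFree.sum_adj_sign_nonpos (hG : TriangleFree G) :
    ∑ v, ∑ w, (if G.Adj v w then (1 : ℤ) else -1) ≤ 0 := by
  have h := hG.two_mul_sum_card_inter_le univ
  simp only [inter_univ, SimpleGraph.card_neighborFinset_eq_degree, card_univ] at h
  simp only [sum_adj_sign, sum_sub_distrib, ← mul_sum, sum_const, card_univ, nsmul_eq_mul]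
  have h' : ((2 * ∑ v, G.degree v : ℕ) : ℤ) ≤ ((Fintype.card V * Fintype.card V : ℕ) : ℤ) :=
    Nat.cast_le.2 h
  push_cast at h'
  linarith

/-- Graphs that satisfy an Ore-type condition have more than half of all possible edges. -/
lemma sum_adj_sign_pos (hn : 3 ≤ Fintype.card V)
    (hadj : ∀ u v, G.Adj u v → Fintype.card V ≤ G.degree u + G.degree v)
    (hnon : ∀ u v, u ≠ v → ¬ G.Adj u v → Fintype.card V + 1 ≤ G.degree u + G.degree v) :
    0 < ∑ v, ∑ w, (if G.Adj v w then (1 : ℤ) else -1) := by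
  simp only [sum_adj_sign]
  set e : V → ℤ := fun v => 2 * (G.degree v : ℤ) - Fintype.card V with he
  have hpair : ∀ u v, u ≠ v → 0 ≤ e u + e v := by
    intro u v huv
    by_cases h : G.Adj u v
    · have := hadj u v h
      simp only [he]; omega
    · have := hnon u v huv h
      simp only [he]; omega
  have hpair' : ∀ u v, u ≠ v → ¬ G.Adj u v → 2 ≤ e u + e v := by
    intro u v huv h
    have := hnon u v huv h
    simp only [he]; omega
  obtain ⟨x⟩ : Nonempty V := Fintype.card_pos_iff.1 (by omega)
  obtain ⟨v, -, hv⟩ := univ.exists_min_image e ⟨x, mem_univ x⟩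
  -- If the least excess e v is negative, all others are at least -e v and the sum is at least (n -
  -- 2)(-e v). Otherwise the sum vanishes only if all excesses do; then no two vertices are
  -- non-adjacent, and n - 1 = n/2 is impossible for n ≥ 3.
  rcases lt_or_ge (e v) 0 with hneg | hpos
  · rw [← add_sum_erase univ e (mem_univ v)]
    have h1 : #(univ.erase v) • (-e v) ≤ ∑ w ∈ univ.erase v, e w := by
      refine card_nsmul_le_sum _ _ _ fun w hw => ?_
      have := hpair v w (ne_of_mem_erase hw).symm
      linarith
    rw [card_erase_of_mem (mem_univ v), card_univ, nsmul_eq_mul] at h1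
    have h2 : (2 : ℤ) ≤ ((Fintype.card V - 1 : ℕ) : ℤ) := by
      have : 2 ≤ Fintype.card V - 1 := by omega
      exact_mod_cast this
    nlinarith
  · have hnonneg : ∀ w ∈ univ, 0 ≤ e w := fun w hw => hpos.trans (hv w hw)
    refine lt_of_le_of_ne (sum_nonneg hnonneg) fun h0 => ?_
    have hzero := (sum_eq_zero_iff_of_nonneg hnonneg).1 h0.symm
    have hall : ∀ w, w ≠ v → G.Adj v w := by
      intro w hw
      by_contra h
      have := hpair' v w hw.symm h
      rw [hzero v (mem_univ v), hzero w (mem_univ w)] at this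
      omega
    have hdeg : G.degree v = Fintype.card V - 1 := by
      rw [← SimpleGraph.card_neighborFinset_eq_degree, ← card_univ,
        ← card_erase_of_mem (mem_univ v)]
      congr 1
      ext w
      simp only [SimpleGraph.mem_neighborFinset, mem_erase, mem_univ, and_true]
      exact ⟨fun h => h.ne', hall w⟩
    have := hzero v (mem_univ v)
    simp only [he, hdeg] at this
    omega

end Balance

/-! ### Cuts and scramble number under the Ore-type condition -/

section Ore

variable {V : Type*} [Fintype V] [DecidableEq V] {G : SimpleGraph V} [DecidableRel G.Adj]

/-- Cuts are large if any two vertices have large degree sum. -/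
lemma card_le_two_mul_outdegree_of_degree_add
    (hsum : ∀ u v, u ≠ v → Fintype.card V ≤ G.degree u + G.degree v) (A : Finset V)
    (h2 : 2 ≤ #A) (hA : 2 * #A ≤ Fintype.card V) : Fintype.card V ≤ 2 * outdegree G A := by
  obtain ⟨r, hr⟩ := Nat.exists_eq_add_of_le h2
  obtain ⟨t, ht⟩ := Nat.exists_eq_add_of_le hA
  set c : V → ℕ := fun x => #(G.neighborFinset x \ A) with hc
  have hC : outdegree G A = ∑ x ∈ A, c x := outdegree_eq_sum G A
  have hdeg : ∀ x ∈ A, G.degree x ≤ c x + (r + 1) := by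
    intro x hx
    have h1 := card_inter_add_card_sdiff (G := G) A x
    have h3 : #(G.neighborFinset x ∩ A) ≤ #(A.erase x) := card_le_card fun y hy => by
      rw [mem_inter, SimpleGraph.mem_neighborFinset] at hy
      exact mem_erase.2 ⟨hy.1.ne', hy.2⟩
    rw [card_erase_of_mem hx] at h3
    simp only [hc]
    omega
  have hpair : ∀ x ∈ A, ∀ y ∈ A, x ≠ y → t + 2 ≤ c x + c y := by
    intro x hx y hy hxy
    have h1 := hdeg x hx
    have h3 := hdeg y hy
    have h4 := hsum x y hxy
    omega
  -- Let a = |A|, n = 2a + t and let C be the cut. Pairing the minimiser v with all other vertices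
  -- gives (a - 1)(t + 2) ≤ (a - 2)c(v) + C. With a·c(v) ≤ C this becomes a(t + 2) ≤ 2C, and a(t +
  -- 2) ≥ n.
  obtain ⟨v, hv, hmin⟩ := A.exists_min_image c (card_pos.1 (by omega))
  have h3 : #A * c v ≤ outdegree G A := by
    rw [hC, ← smul_eq_mul]
    exact card_nsmul_le_sum _ _ _ hmin
  have h4 : (r + 1) * (t + 2) ≤ (r + 1) * c v + ∑ x ∈ A.erase v, c x := by
    have hcard : #(A.erase v) = r + 1 := by rw [card_erase_of_mem hv]; omega
    have := card_nsmul_le_sum (A.erase v) (fun x => c v + c x) (t + 2) fun x hx =>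
      hpair v hv x (mem_of_mem_erase hx) (ne_of_mem_erase hx).symm
    rwa [sum_add_distrib, sum_const, hcard, smul_eq_mul, smul_eq_mul] at this
  have h5 : c v + ∑ x ∈ A.erase v, c x = outdegree G A := by
    rw [hC]
    exact add_sum_erase A c hv
  rw [hr] at h3 ht
  have h6 : (r + 1) * ((r + 2) * (t + 2)) ≤ (r + 1) * (2 * outdegree G A) := by
    have h7 : (r + 1) * (t + 2) ≤ r * c v + outdegree G A := by
      rw [← h5]; linarith
    have h8 : r * ((2 + r) * c v) ≤ r * outdegree G A := Nat.mul_le_mul_left _ h3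
    nlinarith [Nat.mul_le_mul_left (r + 2) h7]
  have h9 := Nat.le_of_mul_le_mul_left h6 (Nat.succ_pos r)
  rw [ht]
  nlinarith

/-- The scramble number is at least half the number of vertices under an Ore-type condition. -/
lemma half_card_le_sn (hn : 1 ≤ Fintype.card V)
    (hadj : ∀ u v, G.Adj u v → Fintype.card V ≤ G.degree u + G.degree v)
    (hnon : ∀ u v, u ≠ v → ¬ G.Adj u v → Fintype.card V + 1 ≤ G.degree u + G.degree v) :
    (((Fintype.card V + 1) / 2 : ℕ) : ℕ∞) ≤ sn G := by
  obtain ⟨x⟩ : Nonempty V := Fintype.card_pos_iff.1 (by omega)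
  rcases hn.eq_or_lt with h1 | h1
  · rw [← h1]
    exact one_le_sn x
  have hsum : ∀ u v, u ≠ v → Fintype.card V ≤ G.degree u + G.degree v := by
    intro u v huv
    by_cases h : G.Adj u v
    · exact hadj u v h
    · exact (Nat.le_succ _).trans (hnon u v huv h)
  obtain ⟨a, b, hab⟩ : ∃ a b, G.Adj a b := by
    obtain ⟨u, v, huv⟩ := Fintype.exists_pair_of_one_lt_card h1
    have h2 := hsum u v huv
    rcases Nat.eq_zero_or_pos (G.degree u) with h | h
    · obtain ⟨w, hw⟩ := card_pos.1 (show 0 < #(G.neighborFinset v) by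
        rw [SimpleGraph.card_neighborFinset_eq_degree]; omega)
      exact ⟨v, w, by simpa using hw⟩
    · obtain ⟨w, hw⟩ := card_pos.1 (show 0 < #(G.neighborFinset u) by
        rwa [SimpleGraph.card_neighborFinset_eq_degree])
      exact ⟨u, w, by simpa using hw⟩
  set S : Set G.Subgraph := {H | ∃ (u v : V) (h : G.Adj u v), H = G.subgraphOfAdj h} with hSdef
  have hS : IsScramble G S :=
    ⟨⟨_, a, b, hab, rfl⟩, by
      rintro H ⟨u, v, h, rfl⟩
      exact SimpleGraph.Subgraph.subgraphOfAdj_connected h⟩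
  have hegg : ∀ A : Finset V, (∃ H ∈ S, H.verts ⊆ (A : Set V)) → 2 ≤ #A := by
    rintro A ⟨H, ⟨u, v, h, rfl⟩, hA⟩
    have hu : u ∈ A := hA (by simp)
    have hv : v ∈ A := hA (by simp)
    exact one_lt_card.2 ⟨u, hu, v, hv, h.ne⟩
  refine le_trans (le_min (le_iInf₂ fun T hT => Nat.cast_le.2 ?_) (le_eggCutNumber ?_))
    (le_iSup₂_of_le S hS le_rfl)
  · have hcover : ∀ u v, G.Adj u v → u ∉ T → v ∈ T := by
      intro u v h hu
      obtain ⟨w, hw, hwv⟩ := hT _ ⟨u, v, h, rfl⟩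
      rcases hwv with rfl | hwv
      · exact absurd hw hu
      · rw [Set.mem_singleton_iff] at hwv
        exact hwv ▸ hw
    have hdeg : ∀ u ∉ T, G.degree u ≤ #T := fun u hu => card_le_card fun v hv =>
      hcover u v (by simpa using hv) hu
    -- A hitting set is a vertex cover. Two vertices outside it are non-adjacent with all neighbours
    -- in T, so 2|T| ≥ n + 1; otherwise |T| ≥ n - 1.
    by_cases hI : ∃ u v, u ∉ T ∧ v ∉ T ∧ u ≠ v
    · obtain ⟨u, v, hu, hv, huv⟩ := hI
      have h2 := hnon u v huv fun h => hv (hcover u v h hu)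
      have h3 := hdeg u hu
      have h4 := hdeg v hv
      omega
    · push Not at hI
      have h2 : #Tᶜ ≤ 1 := card_le_one.2 fun u hu v hv =>
        hI u v (mem_compl.1 hu) (mem_compl.1 hv)
      have h3 : #T + #Tᶜ = Fintype.card V := card_add_card_compl T
      omega
  · intro A h₁ h₂
    have h2 := hegg A h₁
    have h3 := hegg Aᶜ (by simpa using h₂)
    have h4 : #A + #Aᶜ = Fintype.card V := card_add_card_compl A
    rcases le_total #A #Aᶜ with h | h
    · have := card_le_two_mul_outdegree_of_degree_add hsum A h2 (by omega)
      omega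
    · have := card_le_two_mul_outdegree_of_degree_add hsum Aᶜ h3 (by omega)
      rw [outdegree_compl] at this
      omega

end Ore

/-! ### Approximation in triangle-free graphs -/

section Main

variable {V : Type*} [Fintype V] [DecidableEq V] {G : SimpleGraph V} [DecidableRel G.Adj]

/-- Packings of two-edge paths with dissociated complement approximate gonality and scramble number
if there is no small cut with two-edge paths on both sides. -/
lemma IsPathPacking.approximates {P : Finset (Finset V)} (hP : IsPathPacking G P)
    (hne : P.Nonempty) (hX : IsDissociation G {v | v ∉ P.biUnion id}) (hG : TriangleFree G)
    (hδ : ∀ v, 2 ≤ G.degree v) {ρ : ℕ} (hρ : 3 ≤ ρ)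
    (hcut : ∀ (A : Finset V) (u v w : V), 2 * #A ≤ Fintype.card V → G.Adj v u → G.Adj v w →
      u ≠ w → u ∈ A → v ∈ A → w ∈ A → #P ≤ outdegree G A) :
    Approximates ρ G (3 * #P, #P) := by
  refine approximates_of_le ?_ (hP.card_le_sn hne ?_) (by gcongr)
  · rw [← hP.card_biUnion]
    exact gon_le_of_isDissociation G hG hδ _ hX
  · rintro A ⟨u₁, v₁, w₁, hu₁, hw₁, hne₁, huA₁, hvA₁, hwA₁⟩
      ⟨u₂, v₂, w₂, hu₂, hw₂, hne₂, huA₂, hvA₂, hwA₂⟩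
    have h4 : #A + #Aᶜ = Fintype.card V := card_add_card_compl A
    rcases le_total #A #Aᶜ with h | h
    · exact hcut A u₁ v₁ w₁ (by omega) hu₁ hw₁ hne₁ huA₁ hvA₁ hwA₁
    · rw [← outdegree_compl]
      exact hcut Aᶜ u₂ v₂ w₂ (by omega) hu₂ hw₂ hne₂ (mem_compl.2 huA₂) (mem_compl.2 hvA₂)
        (mem_compl.2 hwA₂)

lemma IsDissociation.nonempty_of_two_le_degree [Nonempty V] {P : Finset (Finset V)}
    (hX : IsDissociation G {v | v ∉ P.biUnion id}) (hδ : ∀ v, 2 ≤ G.degree v) : P.Nonempty := by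
  by_contra hP
  rw [not_nonempty_iff_eq_empty] at hP
  subst hP
  obtain ⟨v⟩ := ‹Nonempty V›
  obtain ⟨u, hu, w, hw, huw⟩ := one_lt_card.1 (show 1 < #(G.neighborFinset v) from hδ v)
  exact huw (hX v (by simp) u (by simp) w (by simp) (by simpa using hu) (by simpa using hw))

/-- The approximation in dense triangle-free graphs. -/
lemma IsPathPacking.approximates_of_dense {P : Finset (Finset V)} (hP : IsPathPacking G P)
    (hne : P.Nonempty) (hX : IsDissociation G {v | v ∉ P.biUnion id}) (hG : TriangleFree G)
    (hδ : ∀ v, 2 ≤ G.degree v) {ρ : ℕ} (hρ : 3 ≤ ρ)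
    (hdense : ∀ v, Fintype.card V + 4 ≤ 4 * G.degree v) : Approximates ρ G (3 * #P, #P) := by
  refine hP.approximates hne hX hG hδ hρ fun A u v w hA hu hw huw huA hvA hwA => ?_
  have h3 : 3 ≤ #A := by
    have hsub : ({u, v, w} : Finset V) ⊆ A := by
      intro x hx
      simp only [mem_insert, mem_singleton] at hx
      rcases hx with rfl | rfl | rfl <;> assumption
    exact (card_eq_three.2 ⟨u, v, w, hu.ne', huw, hw.ne, rfl⟩).symm.le.trans (card_le_card hsub)
  have h1 := hG.card_le_two_mul_outdegree hdense A h3 hA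
  have h2 := hP.three_mul_card_le
  omega

end Main

end GraphApprox

/-! ### The four cases -/

theorem theorem1p5 :
    ∃ f : GraphApprox.FinGraph → ℕ × ℕ, GraphApprox.IsPolyTime f ∧
      ∀ (n : ℕ) (G : SimpleGraph (Fin n)) [DecidableRel G.Adj], G.Connected →
        (4 ≤ G.egirth → 3 ≤ G.minDegree → ((n + 1 : ℕ) : ℕ∞) ≤ GraphApprox.xi G 3 →
          GraphApprox.Approximates 3 G (f ⟨n, G⟩)) ∧
        (4 ≤ G.egirth → 6 ≤ n → (n : ℝ) / 3 + 1 ≤ (G.minDegree : ℝ) →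
          GraphApprox.Approximates 3 G (f ⟨n, G⟩)) ∧
        (5 ≤ G.egirth → 8 ≤ n →
          (1 / 2 : ℝ) * ((⌊(n : ℝ) / 2⌋ : ℝ) + 4) ≤ (G.minDegree : ℝ) →
          GraphApprox.Approximates 4 G (f ⟨n, G⟩)) ∧
        ((∀ u v : Fin n, G.Adj u v → n ≤ G.degree u + G.degree v) →
          (∀ u v : Fin n, u ≠ v → ¬ G.Adj u v → n + 1 ≤ G.degree u + G.degree v) →
          GraphApprox.Approximates 2 G (f ⟨n, G⟩)) := by
  obtain ⟨f, hf, hval⟩ := GraphApprox.exists_isPolyTime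
  refine ⟨f, hf, fun n G _ hconn => ?_⟩
  obtain ⟨P, hP, hX, hfx⟩ := hval ⟨n, G⟩
  simp only at P hP hX hfx
  have hbal : ∑ i, ∑ j, (@ite ℤ (G.Adj i j) (Classical.propDecidable _) 1 (-1)) =
      ∑ i, ∑ j, (if G.Adj i j then (1 : ℤ) else -1) :=
    Finset.sum_congr rfl fun i _ => Finset.sum_congr rfl fun j _ => by congr
  rw [hbal] at hfx
  have : Nonempty (Fin n) := hconn.nonempty
  have hn : 1 ≤ n := Fin.pos_iff_nonempty.2 this
  have hcard : Fintype.card (Fin n) = n := Fintype.card_fin n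
  have hsparse : GraphApprox.TriangleFree G → (∀ v, 2 ≤ G.degree v) →
      P.Nonempty ∧ f ⟨n, G⟩ = (3 * P.card, P.card) := by
    intro hG hδ
    have hne := hX.nonempty_of_two_le_degree hδ
    refine ⟨hne, ?_⟩
    rw [hfx, if_neg]
    rintro (h | h)
    · exact absurd h hG.sum_adj_sign_nonpos.not_gt
    · exact hne.card_pos.ne' h
  -- Common to cases 2 and 3: 3δ ≥ n + 3 with n ≥ 6 forces δ ≥ 3, hence 4δ ≥ n + 6; and 2δ ≥ ⌊n/2⌋ +
  -- 4 gives 4δ ≥ n + 7.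
  have hdense : 4 ≤ G.egirth → 2 ≤ G.minDegree → n + 4 ≤ 4 * G.minDegree → ∀ ρ, 3 ≤ ρ →
      GraphApprox.Approximates ρ G (f ⟨n, G⟩) := by
    intro hgirth h2 h4 ρ hρ
    have hG := GraphApprox.triangleFree_of_egirth hgirth
    have hδ : ∀ v, 2 ≤ G.degree v := fun v => h2.trans (G.minDegree_le_degree v)
    obtain ⟨hne, hfx'⟩ := hsparse hG hδ
    rw [hfx']
    refine hP.approximates_of_dense hne hX hG hδ hρ fun v => ?_
    have := G.minDegree_le_degree v
    omega
  refine ⟨fun hgirth h3 hxi => ?_, fun hgirth h6 hδ => ?_, fun hgirth h8 hδ => ?_,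
    fun hadj hnon => ?_⟩
  · have hG := GraphApprox.triangleFree_of_egirth hgirth
    have hδ : ∀ v, 2 ≤ G.degree v := fun v =>
      (Nat.le_succ 2).trans (h3.trans (G.minDegree_le_degree v))
    obtain ⟨hne, hfx'⟩ := hsparse hG hδ
    rw [hfx']
    refine hP.approximates hne hX hG hδ le_rfl fun A u v w hA hu hw huw huA hvA hwA =>
      hG.card_le_outdegree_of_path hδ (fun u v w hu hw huw => ?_) hP A hA hu hw huw huA hvA hwA
    rw [hcard]
    exact GraphApprox.degree_sum_of_le_xi hxi hu hw huw
  · have h1 : n + 3 ≤ 3 * G.minDegree := by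
      have : (n : ℝ) + 3 ≤ 3 * G.minDegree := by linarith
      exact_mod_cast this
    exact hdense hgirth (by omega) (by omega) 3 le_rfl
  · have hfloor : (⌊(n : ℝ) / 2⌋ : ℝ) = ((n / 2 : ℕ) : ℝ) := by
      have : ⌊(n : ℝ) / 2⌋ = ((n / 2 : ℕ) : ℤ) := by
        rw [← Nat.floor_div_eq_div (K := ℝ), Int.natCast_floor_eq_floor (by positivity)]
        norm_num
      rw [this]; norm_cast
    rw [hfloor] at hδ
    have h1 : n / 2 + 4 ≤ 2 * G.minDegree := by
      have : ((n / 2 : ℕ) : ℝ) + 4 ≤ 2 * G.minDegree := by linarith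
      exact_mod_cast this
    exact hdense (le_trans (by norm_num) hgirth) (by omega) (by omega) 4 (by norm_num)
  · have hfx' : f ⟨n, G⟩ = (n, (n + 1) / 2) := by
      rw [hfx, if_pos]
      -- On at most two vertices the balance is not positive, but no two-edge path fits, so the
      -- packing is empty.
      rcases Nat.lt_or_ge n 3 with h | h
      · have := hP.three_mul_card_le
        right
        omega
      · left
        exact GraphApprox.sum_adj_sign_pos (by omega) (by simpa only [hcard] using hadj)
          (by simpa only [hcard] using hnon)
    rw [hfx']
    refine GraphApprox.approximates_of_le ?_ ?_ (by omega)
    · exact (GraphApprox.gon_le_card G).trans hcard.le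
    · have := GraphApprox.half_card_le_sn (G := G) (by omega) (by simpa only [hcard] using hadj)
        (by simpa only [hcard] using hnon)
      rwa [hcard] at this
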